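/- Let $\mathcal H=\{\tau\in\mathbb C:\operatorname{Im}\tau>0\}$, let $\Sigma=S^2\setminus\{0,1,\infty\}=\{z\in\mathbb C: z\neq 0,1\}$, let $$\Gamma_1(4)=\left\{\begin{pmatrix}a&b\\c&d\end{pmatrix}\in \mathrm{SL}(2,\mathbb Z): a\equiv d\equiv 1,\ c\equiv 0 \bmod 4\right\},$$ acting on $\mathcal H$ by Möbius transformations, and let $$\theta(\tau)=\sum_{n\in\mathbb Z}q^{n^2},\quad q=e^{2\pi i\tau},\qquad \Theta=\theta(\tau)^4\,d\tau\quad\text{on }\mathcal H .$$ Let $\mathcal D=\{\tau\in\mathcal H: 0<\operatorname{Re}\tau<1,\ |\tau-\tfrac14|>\tfrac14,\ |\tau-\tfrac34|>\tfrac14\}$. There is a conformal isomorphism $f$ from the slit plane $\mathbb C\setminus((-\infty,0]\cup[1,\infty))$ onto $\mathcal D$, normalised by $f(1/2)=(1+i)/2$ and $f'(1/2)\in -i\,\mathbb R_{>0}$. For any such $f$, the inverse $f^{-1}:\mathcal D\to\mathbb C$ extends to a unique holomorphic function $\pi$ on $\mathcal H$. The map $\pi$ is a locally conformal surjection $\mathcal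 H\to\Sigma$ whose fibres are exactly the $\Gamma_1(4)$-orbits, so that it induces $\Gamma_1(4)\backslash\mathcal H\cong\Sigma$. The form $\Theta$ descends to $\Sigma$, where, in the usual coordinate $z$, it equals $dz/(2\pi i z)$: a $1$-form $\omega$ on $\Sigma$ satisfies $\pi^*\omega=\Theta$ on $\mathcal H$ if and only if $$\omega=\frac{dz}{2\pi i z}.$$ -/

import Mathlib

namespace ThetaForm

/-- The upper half plane `𝓗 = {τ = s + it ∣ t > 0}`, as an open subset of `ℂ`. -/
def halfPlane : Set ℂ := {τ | 0 < τ.im}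

/-- The thrice-punctured sphere `S² ∖ {0, 1, ∞} = {z ∈ ℂ ∣ z ≠ 0, 1}`, with its usual
coordinate `z`. -/
def puncturedSphere : Set ℂ := {z | z ≠ 0 ∧ z ≠ 1}

/-- The plane slit along two rays, `ℂ ∖ ((-∞, 0] ∪ [1, ∞))`. -/
def slitDomain : Set ℂ := {z | ¬ (z.im = 0 ∧ (z.re ≤ 0 ∨ 1 ≤ z.re))}

/-- The part of the strip `0 < s < 1` of the upper half plane lying above the two semicircles
with diameters `[0, 1/2]` and `[1/2, 1]`. -/
def extendedTile : Set ℂ :=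
  {τ | 0 < τ.im ∧ 0 < τ.re ∧ τ.re < 1 ∧ 1 / 4 < ‖τ - 1 / 4‖ ∧ 1 / 4 < ‖τ - 3 / 4‖}

/-- `f` is the Riemann mapping from the slit plane onto the extended tile which sends `z = 1/2` to
`τ = (1 + i)/2` and, at these points, the direction `∂/∂x` to `-∂/∂t`. -/
structure IsRiemannMap (f : ℂ → ℂ) : Prop where
  holomorphic : DifferentiableOn ℂ f slitDomain
  bijective : Set.BijOn f slitDomain extendedTile
  base_point : f (1 / 2) = (1 + Complex.I) / 2
  direction : ∃ r : ℝ, 0 < r ∧ deriv f (1 / 2) = -(r * Complex.I)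

/-- `π` is the holomorphic extension to the whole upper half plane of the inverse of `f`.
It expresses the coordinate `z` in terms of `τ`. -/
structure IsUniformization (f π : ℂ → ℂ) : Prop where
  holomorphic : DifferentiableOn ℂ π halfPlane
  inverse : ∀ z ∈ slitDomain, π (f z) = z

/-- `π` maps the upper half plane onto the thrice-punctured sphere, is locally conformal, and its
fibres are the orbits of `Γ₁(4)`: it identifies `Γ₁(4) \ 𝓗` with the thrice-punctured sphere. -/
structure IsConformalQuotient (π : ℂ → ℂ) : Prop where
  image_eq : π '' halfPlane = puncturedSphere
  conformal : ∀ τ ∈ halfPlane, DifferentiableAt ℂ π τ ∧ deriv π τ ≠ 0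
  fibres : ∀ τ τ' : UpperHalfPlane,
    π τ = π τ' ↔ ∃ γ ∈ CongruenceSubgroup.Gamma1 4, γ • τ = τ'

/-- (Complex-linear) `1`-forms on (subsets of) `ℂ`. -/
abbrev OneForm : Type := ℂ → ℂ →L[ℂ] ℂ

/-- The differential of the standard coordinate of `ℂ` (called `z` or `τ`). -/
noncomputable def dCoord : OneForm := fun _ => ContinuousLinearMap.id ℂ ℂ

/-- The pullback `π^* ω`. -/
noncomputable def pullback (π : ℂ → ℂ) (ω : OneForm) : OneForm :=
  fun τ => (ω (π τ)).comp (fderiv ℂ π τ)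

/-- Jacobi's theta function `θ(q) = ∑_{n ∈ ℤ} q^{n²}`, for `|q| < 1`. -/
noncomputable def theta (q : ℂ) : ℂ := ∑' n : ℤ, q ^ (n ^ 2)

/-- `Θ = θ(τ)⁴ dτ`, where `θ(τ)` means `θ(q)` with `q = e^{2πiτ}`. -/
noncomputable def Theta : OneForm :=
  fun τ => (theta (Complex.exp (2 * Real.pi * Complex.I * τ))) ^ 4 • dCoord τ

/-- The `1`-form `dz / (2πiz)`. -/
noncomputable def dzOver : OneForm :=
  fun z => (1 / (2 * Real.pi * Complex.I * z)) • dCoord z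

end ThetaForm

/-!
The inverse of the Riemann map is given by an explicit modular function. With `q = e^{2πiτ}`, let
`π(τ) = 1 - (θ(q) / θ(-q))⁴`; this is `hauptmodul`, and it equals `λ(-q)` for the elliptic modulus
`λ(q) = 1 - (θ(-q) / θ(q))⁴`, which is `lam`.

*Identities on the unit disc.* Rearranging the series gives `θ(q) + θ(-q) = 2 θ(q⁴)` and
`θ(q)² + θ(-q)² = 2 θ(q²)²`. All further identities follow from these by algebra, in particular
`θ(q) θ(-q) = θ(-q²)²` and the Landen transformation, which expresses `λ(q²)` by
`θ(-q)² / θ(q)²`. A zero of `θ` or of `λ` in the punctured disc would therefore propagate along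
`q, q², q⁴, …` towards `0`, where there is none. In the same way, the quotient of `q λ'(q)` and
`θ(-q)⁴ λ(q)` is invariant under `q ↦ q²` and tends to `1` at `0`, so it is `1` (`deriv_lam`). This
is `dπ / (2πi π) = θ⁴ dτ`, the formula for the form `Θ`, and it also shows that `π` is locally
conformal.

*Invariance.* The functional equation of the theta function under `τ ↦ -1/(4τ)` yields
`π(-1/(4τ)) = 1/π(τ)`. As `π` has period `1`, it is invariant under `τ ↦ τ/(4nτ + 1)`, and hence
under `Γ₁(4)` by a Euclidean algorithm (`hauptmodul_smul`).

*The tile.* On the boundary of the left half of the tile, an ideal triangle with vertices `0`, `1/2`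
and `i∞`, the function `π` is real, and it is proper as a map from the closed half tile to
`ℂ ∖ {0, 1}`. So the image of the half tile is open and closed away from the real line; so is the
set of values taken more than once. Close to the value `0` everything is controlled by
`π = -16 q + O(q²)`: values in the upper half plane do not occur, and values in the lower half plane
occur at most once. Therefore the half tile is mapped bijectively onto the lower half plane
(`image_halfTile`, `injOn_halfTile`). Reflecting in the line `Re τ = 1/2` gives the bijection of the
tile with the slit plane (`bijOn_extendedTile`).

*The fibres.* Each `Γ₁(4)`-orbit meets the closure of the tile, by minimising `|cτ + d|`. Hence
two points with the same non-real value are in the same orbit, and the case of a real value follows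
by a limit argument from the proper discontinuity of the action (`exists_smul_eq`).

*Uniqueness of the Riemann map.* The slit plane is the image of the unit disc under
`ζ ↦ 1/2 + 1/(ζ + ζ⁻¹)`, so two normalised Riemann maps differ by an automorphism of the disc with
fixed point `0` and positive derivative there, which is the identity by the Schwarz lemma and the
maximum principle (`eq_id_of_bijOn_ball`).
-/

namespace ThetaForm

open Filter Topology Complex
open scoped MatrixGroups

/-! ### Theta series on the unit disc -/

lemma norm_zpow_sq_le {q : ℂ} {r : ℝ} (hq : ‖q‖ ≤ r) (hr : r ≤ 1) (n : ℤ) :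
    ‖q ^ (n ^ 2)‖ ≤ r ^ n.natAbs := by
  have h : n ^ 2 = ((n.natAbs ^ 2 : ℕ) : ℤ) := by rw [Nat.cast_pow, Int.natAbs_sq]
  rw [h, zpow_natCast, norm_pow]
  calc ‖q‖ ^ (n.natAbs ^ 2) ≤ ‖q‖ ^ n.natAbs :=
        pow_le_pow_of_le_one (norm_nonneg q) (hq.trans hr)
          ((sq n.natAbs).symm ▸ n.natAbs.le_mul_self)
    _ ≤ r ^ n.natAbs := pow_le_pow_left₀ (norm_nonneg q) hq _

lemma summable_pow_natAbs {r : ℝ} (h0 : 0 ≤ r) (hr : r < 1) :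
    Summable fun n : ℤ => r ^ n.natAbs := by
  have h := summable_geometric_of_lt_one h0 hr
  exact Summable.of_nat_of_neg (by simpa using h) (by simpa using h)

lemma summable_norm_zpow_sq {q : ℂ} (hq : ‖q‖ < 1) : Summable fun n : ℤ => ‖q ^ (n ^ 2)‖ :=
  (summable_pow_natAbs (norm_nonneg q) hq).of_nonneg_of_le (fun _ => norm_nonneg _)
    (norm_zpow_sq_le le_rfl hq.le)

lemma hasSum_theta {q : ℂ} (hq : ‖q‖ < 1) : HasSum (fun n : ℤ => q ^ (n ^ 2)) (theta q) :=
  (summable_norm_zpow_sq hq).of_norm.hasSum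

lemma differentiable_zpow_sq (n : ℤ) : Differentiable ℂ fun q : ℂ => q ^ (n ^ 2) := by
  have h : n ^ 2 = ((n.natAbs ^ 2 : ℕ) : ℤ) := by rw [Nat.cast_pow, Int.natAbs_sq]
  simp only [h, zpow_natCast]
  fun_prop

lemma differentiableAt_theta {q : ℂ} (hq : ‖q‖ < 1) : DifferentiableAt ℂ theta q := by
  obtain ⟨r, hqr, hr⟩ := exists_between hq
  have h : DifferentiableOn ℂ theta (Metric.ball 0 r) :=
    differentiableOn_tsum_of_summable_norm
      (summable_pow_natAbs ((norm_nonneg q).trans hqr.le) hr)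
      (fun n => (differentiable_zpow_sq n).differentiableOn) Metric.isOpen_ball
      (fun n w hw => norm_zpow_sq_le (mem_ball_zero_iff.1 hw).le hr.le n)
  exact h.differentiableAt (Metric.isOpen_ball.mem_nhds (by simpa using hqr))

lemma theta_zero : theta 0 = 1 := by
  rw [theta, tsum_eq_single 0]
  · simp
  · intro n hn
    exact zero_zpow _ (pow_ne_zero 2 hn)

lemma hasDerivAt_theta_zero : HasDerivAt theta 2 0 := by
  have hd := (differentiableAt_theta (q := 0) (by simp)).hasDerivAt
  have hs : HasSum (fun n : ℤ => deriv (fun q : ℂ => q ^ (n ^ 2)) 0) (deriv theta 0) :=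
    hasSum_deriv_of_summable_norm (U := Metric.ball 0 (1 / 2))
      (summable_pow_natAbs (r := 1 / 2) (by norm_num) (by norm_num))
      (fun n => (differentiable_zpow_sq n).differentiableOn) Metric.isOpen_ball
      (fun n w hw => norm_zpow_sq_le (mem_ball_zero_iff.1 hw).le (by norm_num) n) (by simp)
  have hs2 : HasSum (fun n : ℤ => deriv (fun q : ℂ => q ^ (n ^ 2)) 0)
      (∑ n ∈ ({1, -1} : Finset ℤ), deriv (fun q : ℂ => q ^ (n ^ 2)) 0) := by
    apply hasSum_sum_of_ne_finset_zero
    intro n hn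
    have h1 : n.natAbs ≠ 1 := by
      intro h
      apply hn
      rcases Int.natAbs_eq n with h' | h' <;> rw [h'] <;> simp [h]
    have h : n ^ 2 = ((n.natAbs ^ 2 : ℕ) : ℤ) := by rw [Nat.cast_pow, Int.natAbs_sq]
    simp only [h, zpow_natCast]
    rcases Nat.eq_zero_or_pos n.natAbs with h0 | h0
    · simp [h0]
    · have : n.natAbs ^ 2 - 1 ≠ 0 := by
        have : 2 ≤ n.natAbs := by omega
        nlinarith [Nat.sub_add_cancel (Nat.one_le_pow 2 n.natAbs h0)]
      simp [this]
  have := hs.unique hs2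
  rw [this] at hd
  convert! hd using 1
  simp
  norm_num

/-- Only the even squares survive in `θ(q) + θ(-q)`. -/
lemma theta_add_theta_neg {q : ℂ} (hq : ‖q‖ < 1) : theta q + theta (-q) = 2 * theta (q ^ 4) := by
  have hq4 : ‖q ^ 4‖ < 1 := by rw [norm_pow]; exact pow_lt_one₀ (norm_nonneg q) hq (by norm_num)
  have h1 := (hasSum_theta hq).add (hasSum_theta (q := -q) (by simpa using hq))
  have hinj : Function.Injective fun m : ℤ => 2 * m := mul_right_injective₀ two_ne_zero
  refine h1.unique ((hinj.hasSum_iff ?_).1 ?_)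
  · intro n hn
    have hodd : Odd n := by
      by_contra h
      rw [Int.not_odd_iff_even] at h
      obtain ⟨m, hm⟩ := h
      exact hn ⟨m, by simp only; omega⟩
    rw [hodd.pow.neg_zpow, add_neg_cancel]
  · convert! (hasSum_theta hq4).mul_left 2 using 2 with m
    have he : Even ((2 * m) ^ 2) := ⟨2 * m ^ 2, by ring⟩
    simp only [Function.comp]
    rw [he.neg_zpow, ← two_mul, ← zpow_natCast q 4, ← zpow_mul]
    congr 2
    push_cast; ring

/-- Substituting `m = u + v`, `n = u - v` in the terms with `m ≡ n mod 2` of the double series. -/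
lemma theta_sq_add_theta_neg_sq {q : ℂ} (hq : ‖q‖ < 1) :
    theta q ^ 2 + theta (-q) ^ 2 = 2 * theta (q ^ 2) ^ 2 := by
  rcases eq_or_ne q 0 with rfl | h0
  · simp [theta_zero]; norm_num
  have hprod : ∀ {p : ℂ}, ‖p‖ < 1 → HasSum (fun x : ℤ × ℤ => p ^ (x.1 ^ 2) * p ^ (x.2 ^ 2))
      (theta p ^ 2) := by
    intro p hp
    have hs := summable_mul_of_summable_norm (f := fun n : ℤ => p ^ (n ^ 2))
      (g := fun n : ℤ => p ^ (n ^ 2)) (summable_norm_zpow_sq hp) (summable_norm_zpow_sq hp)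
    have := (hasSum_theta hp).mul (hasSum_theta hp) hs
    rwa [← sq (theta p)] at this
  have hq2 : ‖q ^ 2‖ < 1 := by rw [norm_pow]; exact pow_lt_one₀ (norm_nonneg q) hq (by norm_num)
  have h1 := (hprod hq).add (hprod (p := -q) (by simpa using hq))
  have hinj : Function.Injective fun x : ℤ × ℤ => (x.1 + x.2, x.1 - x.2) := by
    rintro ⟨a, b⟩ ⟨c, d⟩ h
    simp only [Prod.mk.injEq] at h ⊢
    omega
  have hn0 : -q ≠ 0 := neg_ne_zero.2 h0
  refine h1.unique ((hinj.hasSum_iff ?_).1 ?_)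
  · rintro ⟨m, n⟩ hx
    have hodd : Odd (m + n) := by
      by_contra h
      rw [Int.not_odd_iff_even] at h
      obtain ⟨u, hu⟩ := h
      exact hx ⟨(u, m - u), by simp only [Prod.mk.injEq]; omega⟩
    have : Odd (m ^ 2 + n ^ 2) := by
      have := hodd.pow (n := 2)
      rw [show m ^ 2 + n ^ 2 = (m + n) ^ 2 - 2 * (m * n) by ring]
      exact this.sub_even (even_two_mul _)
    simp only [← zpow_add₀ h0, ← zpow_add₀ hn0]
    rw [this.neg_zpow, add_neg_cancel]
  · convert! (hprod hq2).mul_left 2 using 2 with x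
    have he : Even ((x.1 + x.2) ^ 2 + (x.1 - x.2) ^ 2) := ⟨x.1 ^ 2 + x.2 ^ 2, by ring⟩
    simp only [Function.comp, ← zpow_add₀ h0, ← zpow_add₀ hn0]
    rw [he.neg_zpow, ← two_mul, ← zpow_natCast q 2, ← zpow_mul, ← zpow_mul, ← zpow_add₀ h0]
    congr 2
    push_cast; ring

lemma norm_theta_le {q : ℂ} (hq : ‖q‖ < 1) : ‖theta q‖ ≤ ‖theta (‖q‖ : ℂ)‖ := by
  have h : theta (‖q‖ : ℂ) = ((∑' n : ℤ, ‖q ^ (n ^ 2)‖ : ℝ) : ℂ) := by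
    rw [theta, Complex.ofReal_tsum]
    simp
  rw [h, Complex.norm_real, Real.norm_of_nonneg (tsum_nonneg fun _ => norm_nonneg _)]
  exact norm_tsum_le_tsum_norm (summable_norm_zpow_sq hq)

lemma theta_conj (q : ℂ) : theta (starRingEnd ℂ q) = starRingEnd ℂ (theta q) := by
  rw [theta, theta, Complex.conj_tsum]
  simp

/-! ### The elliptic modulus and its logarithmic derivative -/

lemma norm_sq_lt_one {q : ℂ} (hq : ‖q‖ < 1) : ‖q ^ 2‖ < 1 := by
  rw [norm_pow]; exact pow_lt_one₀ (norm_nonneg q) hq two_ne_zero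

lemma theta_mul_theta_neg {q : ℂ} (hq : ‖q‖ < 1) :
    theta q * theta (-q) = theta (-q ^ 2) ^ 2 := by
  have h1 := theta_add_theta_neg hq
  have h2 := theta_sq_add_theta_neg_sq hq
  have h3 := theta_sq_add_theta_neg_sq (norm_sq_lt_one hq)
  rw [← pow_mul] at h3
  linear_combination (1 / 2) * (theta q + theta (-q) + 2 * theta (q ^ 4)) * h1 - (1 / 2) * h2 - h3

lemma sq_theta_sq_sub {q : ℂ} (hq : ‖q‖ < 1) :
    (theta q ^ 2 - theta (-q) ^ 2) ^ 2 = 4 * (theta (q ^ 2) ^ 4 - theta (-q ^ 2) ^ 4) := by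
  have h1 := theta_mul_theta_neg hq
  have h2 := theta_sq_add_theta_neg_sq hq
  linear_combination (theta q ^ 2 + theta (-q) ^ 2 + 2 * theta (q ^ 2) ^ 2) * h2
    - 4 * (theta q * theta (-q) + theta (-q ^ 2) ^ 2) * h1

lemma iterate_sq (q : ℂ) (n : ℕ) : (fun x : ℂ => x ^ 2)^[n] q = q ^ 2 ^ n := by
  induction n with
  | zero => simp
  | succ n ih => rw [Function.iterate_succ_apply', ih, ← pow_mul, pow_succ]

lemma tendsto_iterate_sq {q : ℂ} (hq : ‖q‖ < 1) (h0 : q ≠ 0) :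
    Tendsto (fun n : ℕ => (fun x : ℂ => x ^ 2)^[n] q) atTop (𝓝[≠] 0) := by
  simp only [iterate_sq]
  refine tendsto_nhdsWithin_of_tendsto_nhds_of_eventually_within _ ?_
    (Eventually.of_forall fun n => pow_ne_zero _ h0)
  exact (tendsto_pow_atTop_nhds_zero_of_norm_lt_one hq).comp
    (tendsto_pow_atTop_atTop_of_one_lt one_lt_two)

/-- A property stable under `q ↦ q²` holds nowhere in the punctured disc if it fails near `0`. -/
lemma not_of_sq_stable {P : ℂ → Prop} (hP : ∀ q, ‖q‖ < 1 → q ≠ 0 → P q → P (q ^ 2))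
    (hlim : ∀ᶠ q in 𝓝[≠] (0 : ℂ), ¬ P q) {q : ℂ} (hq : ‖q‖ < 1) (h0 : q ≠ 0) : ¬ P q := by
  intro h
  have key : ∀ n : ℕ, P ((fun x : ℂ => x ^ 2)^[n] q) := by
    intro n
    induction n with
    | zero => exact h
    | succ n ih =>
      rw [Function.iterate_succ_apply']
      refine hP _ ?_ ?_ ih
      · rw [iterate_sq, norm_pow]; exact pow_lt_one₀ (norm_nonneg q) hq (by positivity)
      · rw [iterate_sq]; exact pow_ne_zero _ h0
  obtain ⟨n, hn⟩ := ((tendsto_iterate_sq hq h0).eventually hlim).exists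
  exact hn (key n)

/-- A function invariant under `q ↦ q²` is equal to its limit at `0`. -/
lemma eq_of_sq_invariant {g : ℂ → ℂ} {l : ℂ} (hg : ∀ q, ‖q‖ < 1 → q ≠ 0 → g (q ^ 2) = g q)
    (hlim : Tendsto g (𝓝[≠] 0) (𝓝 l)) {q : ℂ} (hq : ‖q‖ < 1) (h0 : q ≠ 0) : g q = l := by
  have key : ∀ n : ℕ, g ((fun x : ℂ => x ^ 2)^[n] q) = g q := by
    intro n
    induction n with
    | zero => rfl
    | succ n ih =>
      rw [Function.iterate_succ_apply', hg _ ?_ ?_, ih]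
      · rw [iterate_sq, norm_pow]; exact pow_lt_one₀ (norm_nonneg q) hq (by positivity)
      · rw [iterate_sq]; exact pow_ne_zero _ h0
  have h := hlim.comp (tendsto_iterate_sq hq h0)
  have h2 : g ∘ (fun n : ℕ => (fun x : ℂ => x ^ 2)^[n] q) = fun _ => g q := funext key
  rw [h2] at h
  exact tendsto_nhds_unique tendsto_const_nhds h

lemma eventually_theta_ne_zero : ∀ᶠ q in 𝓝 (0 : ℂ), theta q ≠ 0 :=
  hasDerivAt_theta_zero.continuousAt.eventually_ne (by simp [theta_zero])

lemma tendsto_neg_zero : Tendsto (fun q : ℂ => -q) (𝓝 0) (𝓝 0) := by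
  simpa using (continuous_neg (G := ℂ)).tendsto 0

/-- Zeros of `θ(q) θ(-q) = θ(-q²)²` are stable under `q ↦ q²`. -/
lemma theta_ne_zero {q : ℂ} (hq : ‖q‖ < 1) : theta q ≠ 0 := by
  rcases eq_or_ne q 0 with rfl | h0
  · simp [theta_zero]
  have := not_of_sq_stable (P := fun q => theta q * theta (-q) = 0) (fun q hq _ h => ?_) ?_ hq h0
  · exact fun h => this (by simp [h])
  · have h2 := theta_mul_theta_neg hq
    simp only [h] at h2
    rw [eq_comm, sq_eq_zero_iff] at h2
    simp [h2]
  · refine Eventually.filter_mono nhdsWithin_le_nhds ?_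
    filter_upwards [eventually_theta_ne_zero, tendsto_neg_zero.eventually eventually_theta_ne_zero]
      with q h1 h2 using mul_ne_zero h1 h2

lemma theta_neg_ne_zero {q : ℂ} (hq : ‖q‖ < 1) : theta (-q) ≠ 0 :=
  theta_ne_zero (by simpa using hq)

/-- The elliptic modulus `λ = θ₂⁴ / θ₃⁴` as a function of the nome `q`, written as
`1 - θ₄⁴ / θ₃⁴` with `θ₃ = θ(q)` and `θ₄ = θ(-q)`. -/
noncomputable def lam (q : ℂ) : ℂ := 1 - (theta (-q) / theta q) ^ 4

lemma differentiableAt_lam {q : ℂ} (hq : ‖q‖ < 1) : DifferentiableAt ℂ lam q := by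
  have h1 := differentiableAt_theta hq
  have h2 : DifferentiableAt ℂ (fun q => theta (-q)) q :=
    (differentiableAt_theta (q := -q) (by simpa using hq)).comp q differentiableAt_id.neg
  exact ((h2.div h1 (theta_ne_zero hq)).pow 4).const_sub 1

lemma lam_zero : lam 0 = 0 := by simp [lam, theta_zero]

lemma hasDerivAt_lam_zero : HasDerivAt lam 16 0 := by
  have h1 := hasDerivAt_theta_zero
  have h2 : HasDerivAt (fun q => theta (-q)) (-2) 0 := by
    have h3 : HasDerivAt theta 2 (-0) := by simpa using h1
    have h4 := HasDerivAt.comp (h₂ := theta) (0 : ℂ) h3 (hasDerivAt_neg 0)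
    rwa [mul_neg_one] at h4
  have := ((h2.div h1 (by simp [theta_zero])).pow 4).const_sub 1
  convert! this using 1
  simp [theta_zero]
  norm_num

/-- The Landen transformation. -/
lemma lam_sq {q : ℂ} (hq : ‖q‖ < 1) :
    lam (q ^ 2) = ((1 - (theta (-q) / theta q) ^ 2) / (1 + (theta (-q) / theta q) ^ 2)) ^ 2 := by
  have h1 := theta_sq_add_theta_neg_sq hq
  have h2 := sq_theta_sq_sub hq
  have ha := theta_ne_zero hq
  have ha2 := theta_ne_zero (norm_sq_lt_one hq)
  have hs : theta q ^ 2 + theta (-q) ^ 2 ≠ 0 := by rw [h1]; simp [ha2]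
  have e1 : (1 - (theta (-q) / theta q) ^ 2) / (1 + (theta (-q) / theta q) ^ 2)
      = (theta q ^ 2 - theta (-q) ^ 2) / (theta q ^ 2 + theta (-q) ^ 2) := by
    have : 1 + (theta (-q) / theta q) ^ 2 = (theta q ^ 2 + theta (-q) ^ 2) / theta q ^ 2 := by
      field_simp
    rw [this]
    field_simp
  rw [e1, div_pow, h2, h1, lam]
  field_simp
  ring

lemma one_add_sq_ne_zero {q : ℂ} (hq : ‖q‖ < 1) : 1 + (theta (-q) / theta q) ^ 2 ≠ 0 := by
  have h1 := theta_sq_add_theta_neg_sq hq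
  have ha := theta_ne_zero hq
  have ha2 := theta_ne_zero (norm_sq_lt_one hq)
  have : 1 + (theta (-q) / theta q) ^ 2 = (theta q ^ 2 + theta (-q) ^ 2) / theta q ^ 2 := by
    field_simp
  rw [this, h1]
  exact div_ne_zero (mul_ne_zero two_ne_zero (pow_ne_zero 2 ha2)) (pow_ne_zero 2 ha)

lemma eventually_lam_ne_zero : ∀ᶠ q in 𝓝[≠] (0 : ℂ), lam q ≠ 0 := by
  exact hasDerivAt_lam_zero.eventually_ne (c := 0) (by norm_num)

lemma lam_ne_zero {q : ℂ} (hq : ‖q‖ < 1) (h0 : q ≠ 0) : lam q ≠ 0 := by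
  refine not_of_sq_stable (P := fun q => lam q = 0) (fun q hq _ h => ?_)
    eventually_lam_ne_zero hq h0
  have h' : (1 - (theta (-q) / theta q) ^ 2) * (1 + (theta (-q) / theta q) ^ 2) = 0 := by
    rw [← h, lam]; ring
  have := (mul_eq_zero.1 h').resolve_right (one_add_sq_ne_zero hq)
  rw [lam_sq hq, this]
  simp

/-- The logarithmic derivative of the elliptic modulus: `q dλ/dq = θ₄⁴ λ`. By the Landen
transformation `q ↦ q²`, the quotient of both sides is invariant under `q ↦ q²`, and it tends to
`1` at `q = 0`. -/
lemma deriv_lam {q : ℂ} (hq : ‖q‖ < 1) : q * deriv lam q = theta (-q) ^ 4 * lam q := by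
  rcases eq_or_ne q 0 with rfl | h0
  · simp [lam_zero]
  have hb := theta_neg_ne_zero hq
  have hl := lam_ne_zero hq h0
  suffices h : q * deriv lam q / (theta (-q) ^ 4 * lam q) = 1 from
    (div_eq_one_iff_eq (mul_ne_zero (pow_ne_zero 4 hb) hl)).1 h
  refine eq_of_sq_invariant (g := fun q => q * deriv lam q / (theta (-q) ^ 4 * lam q))
    (fun q hq h0 => ?_) ?_ hq h0
  · have ha := theta_ne_zero hq
    have hb := theta_neg_ne_zero hq
    have hl := lam_ne_zero hq h0
    have hl2 := lam_ne_zero (norm_sq_lt_one hq) (pow_ne_zero 2 h0)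
    have hs := one_add_sq_ne_zero hq
    have hd1 := differentiableAt_theta hq
    have hd2 : DifferentiableAt ℂ (fun q => theta (-q)) q :=
      (differentiableAt_theta (q := -q) (by simpa using hq)).comp q differentiableAt_id.neg
    have hr := ((hd2.div hd1 ha).pow 2).hasDerivAt
    set r : ℂ → ℂ := fun q => (theta (-q) / theta q) ^ 2 with hrdef
    set r' := deriv ((fun q => theta (-q)) / theta) q
    change HasDerivAt r (deriv r q) q at hr
    have e1 : deriv lam q = -(2 * r q * deriv r q) := by
      have : lam = fun q => 1 - r q ^ 2 := by
        funext q; simp only [lam, hrdef]; ring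
      rw [this]
      have := (hr.pow 2).const_sub 1
      simpa using this.deriv
    have e2 : deriv lam (q ^ 2) * (2 * q) =
        2 * ((1 - r q) / (1 + r q)) * ((-deriv r q * (1 + r q) - (1 - r q) * deriv r q)
          / (1 + r q) ^ 2) := by
      have hL : HasDerivAt (fun q => lam (q ^ 2)) (deriv lam (q ^ 2) * (2 * q)) q := by
        have h := (differentiableAt_lam (norm_sq_lt_one hq)).hasDerivAt
        have h2 : HasDerivAt (fun q : ℂ => q ^ 2) (2 * q) q := by simpa using hasDerivAt_pow 2 q
        exact HasDerivAt.comp (h₂ := lam) q h h2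
      have hR := ((hr.const_sub 1).div (hr.const_add 1) hs).pow 2
      have heq : (fun q => lam (q ^ 2)) =ᶠ[𝓝 q] ((fun q => 1 - r q) / fun q => 1 + r q) ^ 2 := by
        have : Metric.ball (0 : ℂ) 1 ∈ 𝓝 q := Metric.isOpen_ball.mem_nhds (by simpa using hq)
        filter_upwards [this] with x hx
        simpa [hrdef] using lam_sq (mem_ball_zero_iff.1 hx)
      have := hL.unique (hR.congr_of_eventuallyEq heq)
      rw [this]
      simp
    -- in terms of `r = θ(-q)² / θ(q)²`, one has `λ(q) = 1 - r²` and `λ(q²) = ((1 - r) / (1 + r))²`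
    have e3 : theta (-q ^ 2) ^ 4 = theta q ^ 2 * theta (-q) ^ 2 := by
      rw [← mul_pow, theta_mul_theta_neg hq, ← pow_mul]
    have e4 : lam (q ^ 2) = ((1 - r q) / (1 + r q)) ^ 2 := lam_sq hq
    have e5 : lam q = (1 - r q) * (1 + r q) := by simp only [lam, hrdef]; ring
    have hm : 1 - r q ≠ 0 := fun h => hl (by rw [e5, h, zero_mul])
    change 1 + r q ≠ 0 at hs
    have e6 : theta (-q) ^ 2 = r q * theta q ^ 2 := by simp only [hrdef]; field_simp
    have hr0 : r q ≠ 0 := by simp only [hrdef]; positivity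
    have e7 : deriv lam (q ^ 2) =
        (1 - r q) / (1 + r q) * ((-2 * deriv r q) / (1 + r q) ^ 2) / q := by
      rw [eq_div_iff h0]
      linear_combination e2 / 2
    have e8 : theta (-q) ^ 4 = r q ^ 2 * theta q ^ 4 := by
      rw [show theta (-q) ^ 4 = (theta (-q) ^ 2) ^ 2 by ring, e6]; ring
    simp only [e3, e4, e5, e1, e7, e6, e8]
    field_simp
  · have hc : ContinuousAt (deriv lam) 0 := by
      have h : DifferentiableOn ℂ lam (Metric.ball 0 1) := fun q hq =>
        (differentiableAt_lam (mem_ball_zero_iff.1 hq)).differentiableWithinAt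
      exact ((h.deriv Metric.isOpen_ball).differentiableAt
        (Metric.isOpen_ball.mem_nhds (by simp))).continuousAt
    have h1 : Tendsto (deriv lam) (𝓝[≠] 0) (𝓝 16) := by
      have := hc.tendsto
      rw [hasDerivAt_lam_zero.deriv] at this
      exact this.mono_left nhdsWithin_le_nhds
    have h2 : Tendsto (fun q => q⁻¹ * lam q) (𝓝[≠] 0) (𝓝 16) := by
      have := hasDerivAt_lam_zero.tendsto_slope
      simpa [slope_fun_def, lam_zero] using this
    have h3 : Tendsto (fun q => theta (-q)) (𝓝[≠] 0) (𝓝 1) := by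
      have := hasDerivAt_theta_zero.continuousAt.tendsto.comp tendsto_neg_zero
      rw [theta_zero] at this
      exact this.mono_left nhdsWithin_le_nhds
    have h4 := h1.div ((h3.pow 4).mul h2) (by norm_num)
    rw [show (16 : ℂ) / (1 ^ 4 * 16) = 1 by norm_num] at h4
    refine h4.congr' ?_
    filter_upwards [self_mem_nhdsWithin, eventually_lam_ne_zero,
      (tendsto_neg_zero.eventually eventually_theta_ne_zero).filter_mono nhdsWithin_le_nhds]
      with q hq h1 h2
    have : q ≠ 0 := hq
    simp only [Pi.div_apply]
    field_simp

/-! ### The hauptmodul and its invariance under `Γ₁(4)` -/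

/-- The nome `q = e^{2πiτ}`. -/
noncomputable def nome (τ : ℂ) : ℂ := exp (2 * Real.pi * I * τ)

/-- The function `λ(-q) = 1 - θ(q)⁴ / θ(-q)⁴` of `τ`, with `q = e^{2πiτ}`. It is the generator
of the function field of `Γ₁(4) \ 𝓗` with value `0` at the cusp `i∞`, `1` at `1/2` and
`∞` at `0`. -/
noncomputable def hauptmodul (τ : ℂ) : ℂ := lam (-nome τ)

lemma nome_ne_zero (τ : ℂ) : nome τ ≠ 0 := exp_ne_zero _

lemma norm_nome (τ : ℂ) : ‖nome τ‖ = Real.exp (-2 * Real.pi * τ.im) := by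
  rw [nome, norm_exp]
  simp

lemma norm_nome_lt_one {τ : ℂ} (hτ : 0 < τ.im) : ‖nome τ‖ < 1 := by
  rw [norm_nome, Real.exp_lt_one_iff]
  have := mul_pos Real.pi_pos hτ
  linarith

lemma norm_neg_nome_lt_one {τ : ℂ} (hτ : 0 < τ.im) : ‖-nome τ‖ < 1 := by
  rw [norm_neg]; exact norm_nome_lt_one hτ

lemma nome_add_int (τ : ℂ) (n : ℤ) : nome (τ + n) = nome τ := by
  rw [nome, nome, mul_add, exp_add,
    show 2 * Real.pi * I * (n : ℂ) = n * (2 * Real.pi * I) by ring, exp_int_mul_two_pi_mul_I,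
    mul_one]

lemma nome_add_half (τ : ℂ) : nome (τ + 1 / 2) = -nome τ := by
  rw [nome, nome, mul_add, exp_add,
    show 2 * Real.pi * I * (1 / 2 : ℂ) = Real.pi * I by ring, exp_pi_mul_I, mul_neg_one]

lemma nome_neg_conj (τ : ℂ) : nome (-starRingEnd ℂ τ) = starRingEnd ℂ (nome τ) := by
  rw [nome, nome, ← exp_conj]
  simp [map_ofNat]

lemma hasDerivAt_nome (τ : ℂ) : HasDerivAt nome (2 * Real.pi * I * nome τ) τ := by
  have := ((hasDerivAt_id τ).const_mul (2 * Real.pi * I : ℂ)).cexp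
  convert! this using 1
  simp [nome, mul_comm]

lemma lam_conj (q : ℂ) : lam (starRingEnd ℂ q) = starRingEnd ℂ (lam q) := by
  simp [lam, ← theta_conj]

lemma one_sub_lam_mul {q : ℂ} (hq : ‖q‖ < 1) : (1 - lam q) * (1 - lam (-q)) = 1 := by
  have h1 := theta_ne_zero hq
  have h2 := theta_neg_ne_zero hq
  simp only [lam, neg_neg]
  field_simp
  ring

lemma hauptmodul_ne_zero {τ : ℂ} (hτ : 0 < τ.im) : hauptmodul τ ≠ 0 :=
  lam_ne_zero (norm_neg_nome_lt_one hτ) (neg_ne_zero.2 (nome_ne_zero τ))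

lemma hauptmodul_ne_one {τ : ℂ} (hτ : 0 < τ.im) : hauptmodul τ ≠ 1 := by
  intro h
  have := one_sub_lam_mul (norm_neg_nome_lt_one hτ)
  rw [show lam (-nome τ) = 1 from h] at this
  simp at this

lemma hasDerivAt_hauptmodul {τ : ℂ} (hτ : 0 < τ.im) :
    HasDerivAt hauptmodul (2 * Real.pi * I * theta (nome τ) ^ 4 * hauptmodul τ) τ := by
  have hq := norm_neg_nome_lt_one hτ
  have h1 := HasDerivAt.comp (h₂ := lam) τ (differentiableAt_lam hq).hasDerivAt
    (hasDerivAt_nome τ).neg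
  have h2 := deriv_lam hq
  rw [neg_neg] at h2
  convert! h1 using 1
  rw [hauptmodul]
  linear_combination (-2 * Real.pi * I) * h2

lemma deriv_hauptmodul_ne_zero {τ : ℂ} (hτ : 0 < τ.im) : deriv hauptmodul τ ≠ 0 := by
  rw [(hasDerivAt_hauptmodul hτ).deriv]
  have h1 := theta_ne_zero (norm_nome_lt_one hτ)
  have h2 := hauptmodul_ne_zero hτ
  simp [h1, h2, Real.pi_ne_zero]

lemma hauptmodul_add_int (τ : ℂ) (n : ℤ) : hauptmodul (τ + n) = hauptmodul τ := by
  rw [hauptmodul, nome_add_int, hauptmodul]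

lemma hauptmodul_neg_conj (τ : ℂ) :
    hauptmodul (-starRingEnd ℂ τ) = starRingEnd ℂ (hauptmodul τ) := by
  rw [hauptmodul, nome_neg_conj, ← map_neg, lam_conj, hauptmodul]

/-- The translation `τ ↦ τ + 1/2` acts on the values as `z ↦ z / (z - 1)`. -/
lemma one_sub_hauptmodul_add_half {τ : ℂ} (hτ : 0 < τ.im) :
    (1 - hauptmodul τ) * (1 - hauptmodul (τ + 1 / 2)) = 1 := by
  rw [hauptmodul, hauptmodul, nome_add_half]
  exact one_sub_lam_mul (norm_neg_nome_lt_one hτ)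

/-- The involution `τ ↦ -1/(4τ)` of the upper half plane. -/
noncomputable def fricke (τ : ℂ) : ℂ := -1 / (4 * τ)

lemma ne_zero_of_im_pos {τ : ℂ} (hτ : 0 < τ.im) : τ ≠ 0 := by
  rintro rfl; simp at hτ

lemma fricke_im (τ : ℂ) : (fricke τ).im = τ.im / (4 * normSq τ) := by
  rw [fricke, show (-1 : ℂ) / (4 * τ) = ((-1 / 4 : ℝ) : ℂ) * τ⁻¹ by push_cast; ring,
    im_ofReal_mul, inv_im]
  ring

lemma fricke_re (τ : ℂ) : (fricke τ).re = -τ.re / (4 * normSq τ) := by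
  rw [fricke, show (-1 : ℂ) / (4 * τ) = ((-1 / 4 : ℝ) : ℂ) * τ⁻¹ by push_cast; ring,
    re_ofReal_mul, inv_re]
  ring

lemma fricke_im_pos {τ : ℂ} (hτ : 0 < τ.im) : 0 < (fricke τ).im := by
  rw [fricke_im]
  have := normSq_pos.2 (ne_zero_of_im_pos hτ)
  positivity

lemma theta_nome_eq_jacobiTheta (τ : ℂ) : theta (nome τ) = jacobiTheta (2 * τ) := by
  rw [theta, jacobiTheta]
  congr 1
  funext n
  rw [nome, ← exp_int_mul]
  congr 1
  push_cast
  ring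

lemma theta_nome_fricke {τ : ℂ} (hτ : 0 < τ.im) :
    theta (nome (fricke τ)) = (-I * (2 * τ)) ^ (1 / 2 : ℂ) * theta (nome τ) := by
  have h2 : 0 < (2 * τ).im := by simpa using hτ
  have h := jacobiTheta_S_smul ⟨2 * τ, h2⟩
  rw [UpperHalfPlane.modular_S_smul] at h
  simp only at h
  rw [theta_nome_eq_jacobiTheta, theta_nome_eq_jacobiTheta, ← h]
  congr 1
  have := ne_zero_of_im_pos hτ
  rw [fricke]
  field_simp
  norm_num

lemma theta_sub_theta_neg_pow_four {q : ℂ} (hq : ‖q‖ < 1) :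
    (theta q - theta (-q)) ^ 4 = 16 * (theta (q ^ 4) ^ 4 - theta (-q ^ 4) ^ 4) := by
  have h1 := theta_add_theta_neg hq
  have h2 := theta_sq_add_theta_neg_sq hq
  have h3 := theta_sq_add_theta_neg_sq (norm_sq_lt_one hq)
  have h4 := sq_theta_sq_sub (norm_sq_lt_one hq)
  rw [← pow_mul] at h3 h4
  have e : (theta q - theta (-q)) ^ 2 = 2 * (theta (q ^ 2) ^ 2 - theta (-q ^ 2) ^ 2) := by
    linear_combination 2 * h2 - (theta q + theta (-q) + 2 * theta (q ^ 4)) * h1 + 2 * h3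
  rw [show (theta q - theta (-q)) ^ 4 = ((theta q - theta (-q)) ^ 2) ^ 2 by ring, e]
  linear_combination 4 * h4

lemma four_mul_cpow_half (x : ℂ) : (4 * x) ^ (1 / 2 : ℂ) = 2 * x ^ (1 / 2 : ℂ) := by
  have h4 : ((4 : ℝ) : ℂ) ^ (1 / 2 : ℂ) = 2 := by
    rw [show (1 / 2 : ℂ) = ((1 / 2 : ℝ) : ℂ) by push_cast; ring,
      ← ofReal_cpow (by norm_num : (0 : ℝ) ≤ 4), ← Real.sqrt_eq_rpow,
      show (4 : ℝ) = 2 ^ 2 by norm_num, Real.sqrt_sq (by norm_num)]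
    norm_num
  rcases eq_or_ne x 0 with rfl | hx
  · simp
  rw [show 4 * x = ((4 : ℝ) : ℂ) * x by norm_num, cpow_def_of_ne_zero (by simpa using hx),
    log_ofReal_mul (by norm_num) hx, add_mul, exp_add, ofReal_log (by norm_num),
    ← cpow_def_of_ne_zero (by norm_num), ← cpow_def_of_ne_zero hx, h4]

lemma cpow_half_sq (x : ℂ) : (x ^ (1 / 2 : ℂ)) ^ 2 = x := by
  rw [← cpow_nat_mul]
  simp

/-- The Jacobi functional equation gives `θ(-q)` at `-1/(4τ)` once `θ(-q)` is expressed as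
`2 θ(q⁴) - θ(q)`. -/
lemma theta_neg_nome_fricke_pow_four {τ : ℂ} (hτ : 0 < τ.im) :
    theta (-nome (fricke τ)) ^ 4 =
      -4 * τ ^ 2 * (theta (nome τ) ^ 4 - theta (-nome τ) ^ 4) := by
  have h0 := ne_zero_of_im_pos hτ
  have hτ4 : 0 < (τ / 4).im := by
    rw [show τ / 4 = ((1 / 4 : ℝ) : ℂ) * τ by push_cast; ring, im_ofReal_mul]; positivity
  have h1 := theta_add_theta_neg (norm_nome_lt_one (fricke_im_pos hτ))
  have hn : nome (fricke τ) ^ 4 = nome (fricke (τ / 4)) := by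
    rw [nome, nome, ← exp_nat_mul, fricke, fricke]
    congr 1
    push_cast
    field_simp
  have hn4 : nome (τ / 4) ^ 4 = nome τ := by
    rw [nome, nome, ← exp_nat_mul]
    congr 1
    push_cast
    ring
  rw [hn, theta_nome_fricke hτ4, theta_nome_fricke hτ,
    show -I * (2 * τ) = 4 * (-I * (2 * (τ / 4))) by ring, four_mul_cpow_half] at h1
  have hs := cpow_half_sq (-I * (2 * (τ / 4)))
  set s := (-I * (2 * (τ / 4))) ^ (1 / 2 : ℂ)
  have h2 := theta_sub_theta_neg_pow_four (norm_nome_lt_one hτ4)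
  have h3 := theta_add_theta_neg (norm_nome_lt_one hτ4)
  rw [hn4] at h2 h3
  have e : theta (-nome (fricke τ)) = s * (theta (nome (τ / 4)) - theta (-nome (τ / 4))) := by
    linear_combination h1 + s * h3
  have hs4 : s ^ 4 = -τ ^ 2 / 4 := by
    rw [show s ^ 4 = (s ^ 2) ^ 2 by ring, hs]
    linear_combination (τ ^ 2 / 4) * I_sq
  rw [e, mul_pow, h2, hs4]
  ring

lemma theta_nome_fricke_pow_four {τ : ℂ} (hτ : 0 < τ.im) :
    theta (nome (fricke τ)) ^ 4 = -4 * τ ^ 2 * theta (nome τ) ^ 4 := by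
  rw [theta_nome_fricke hτ, mul_pow, show ∀ x : ℂ, x ^ 4 = (x ^ 2) ^ 2 by intro x; ring,
    cpow_half_sq]
  linear_combination (4 * τ ^ 2 * theta (nome τ) ^ 4) * I_sq

lemma hauptmodul_eq_div {τ : ℂ} (hτ : 0 < τ.im) :
    hauptmodul τ = (theta (-nome τ) ^ 4 - theta (nome τ) ^ 4) / theta (-nome τ) ^ 4 := by
  have := theta_neg_ne_zero (norm_nome_lt_one hτ)
  rw [hauptmodul, lam, neg_neg]
  field_simp

lemma hauptmodul_fricke {τ : ℂ} (hτ : 0 < τ.im) : hauptmodul (fricke τ) = (hauptmodul τ)⁻¹ := by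
  have h0 := ne_zero_of_im_pos hτ
  have hb := theta_neg_ne_zero (norm_nome_lt_one hτ)
  have hz := hauptmodul_ne_zero hτ
  rw [hauptmodul_eq_div hτ] at hz ⊢
  have hE : theta (-nome τ) ^ 4 - theta (nome τ) ^ 4 ≠ 0 := fun h => hz (by rw [h, zero_div])
  have hE' : theta (nome τ) ^ 4 - theta (-nome τ) ^ 4 ≠ 0 := fun h => hE (by linear_combination -h)
  rw [hauptmodul_eq_div (fricke_im_pos hτ), theta_neg_nome_fricke_pow_four hτ,
    theta_nome_fricke_pow_four hτ]
  field_simp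
  ring

/-- Conjugating the translation by `-n` with the involution `τ ↦ -1/(4τ)`. -/
lemma hauptmodul_lower_unipotent {τ : ℂ} (hτ : 0 < τ.im) (n : ℤ) :
    hauptmodul (τ / (4 * n * τ + 1)) = hauptmodul τ := by
  have h0 := ne_zero_of_im_pos hτ
  have h1 : τ / (4 * n * τ + 1) = fricke (fricke τ + (-n : ℤ)) := by
    rcases eq_or_ne (4 * n * τ + 1) 0 with h | h
    · have h2 : fricke τ + (-n : ℤ) = 0 := by
        rw [fricke]; push_cast; field_simp; linear_combination -h
      rw [h, h2]; simp [fricke]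
    · have h2 : fricke τ + (-n : ℤ) = -(4 * n * τ + 1) / (4 * τ) := by
        rw [fricke]; push_cast; field_simp; ring
      rw [h2, fricke]; field_simp
  have h2 : 0 < (fricke τ + (-n : ℤ)).im := by
    rw [add_im, intCast_im, add_zero]; exact fricke_im_pos hτ
  rw [h1, hauptmodul_fricke h2, hauptmodul_add_int, hauptmodul_fricke hτ, inv_inv]

/-- The matrix `(1 0; 4n 1)`. -/
def lowerUnipotent (n : ℤ) : SL(2, ℤ) := ⟨!![1, 0; 4 * n, 1], by simp [Matrix.det_fin_two]⟩

lemma hauptmodul_lowerUnipotent_smul (n : ℤ) (τ : UpperHalfPlane) :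
    hauptmodul ((lowerUnipotent n • τ : UpperHalfPlane) : ℂ) = hauptmodul τ := by
  rw [UpperHalfPlane.coe_specialLinearGroup_apply, ← hauptmodul_lower_unipotent τ.im_pos n]
  simp [lowerUnipotent]

lemma lowerUnipotent_mem (n : ℤ) : lowerUnipotent n ∈ CongruenceSubgroup.Gamma1 4 := by
  rw [CongruenceSubgroup.Gamma1_mem]
  have : (4 : ZMod 4) = 0 := rfl
  simp [lowerUnipotent, this]

lemma T_zpow_mem (n : ℤ) : ModularGroup.T ^ n ∈ CongruenceSubgroup.Gamma1 4 := by
  rw [CongruenceSubgroup.Gamma1_mem]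
  simp [ModularGroup.coe_T_zpow]

lemma hauptmodul_T_zpow_smul (n : ℤ) (τ : UpperHalfPlane) :
    hauptmodul ((ModularGroup.T ^ n • τ : UpperHalfPlane) : ℂ) = hauptmodul τ := by
  rw [ModularGroup.coe_T_zpow_smul_eq, hauptmodul_add_int]

lemma mem_Gamma1_four_iff (γ : SL(2, ℤ)) : γ ∈ CongruenceSubgroup.Gamma1 4 ↔
    γ 0 0 % 4 = 1 ∧ γ 1 1 % 4 = 1 ∧ γ 1 0 % 4 = 0 := by
  rw [CongruenceSubgroup.Gamma1_mem]
  have h1 : ∀ a : ℤ, (a : ZMod 4) = 1 ↔ a % 4 = 1 := by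
    intro a
    have := ZMod.intCast_eq_intCast_iff a 1 4
    simp only [Int.cast_one, Nat.cast_ofNat] at this
    rw [this]; rfl
  have h0 : ∀ a : ℤ, (a : ZMod 4) = 0 ↔ a % 4 = 0 := by
    intro a
    have := ZMod.intCast_eq_intCast_iff a 0 4
    simp only [Int.cast_zero, Nat.cast_ofNat] at this
    rw [this]; rfl
  rw [h1, h1, h0]

/-- A Euclidean algorithm on the bottom row of a matrix shows that `Γ₁(4)` is generated by the
translation `τ ↦ τ + 1` and the matrix `(1 0; 4 1)`. -/
lemma hauptmodul_smul {γ : SL(2, ℤ)} (hγ : γ ∈ CongruenceSubgroup.Gamma1 4) (τ : UpperHalfPlane) :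
    hauptmodul ((γ • τ : UpperHalfPlane) : ℂ) = hauptmodul τ := by
  induction hn : (γ 1 0).natAbs using Nat.strong_induction_on generalizing γ τ with
  | _ n ih =>
  have hmod := (mem_Gamma1_four_iff γ).1 hγ
  rcases eq_or_ne (γ 1 0) 0 with hc | hc
  · obtain ⟨m, hm⟩ := ModularGroup.exists_eq_T_zpow_of_c_eq_zero hc
    rw [hm, hauptmodul_T_zpow_smul]
  · set c := γ 1 0 with hcdef
    set d := γ 1 1 with hddef
    obtain ⟨k, hk⟩ : ∃ k : ℤ, 2 * |k * c + d| ≤ |c| := by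
      refine ⟨-(round ((d : ℚ) / c)), ?_⟩
      have h := abs_sub_round ((d : ℚ) / c)
      have hcq : (c : ℚ) ≠ 0 := by exact_mod_cast hc
      have h2 : ((-(round ((d : ℚ) / c)) * c + d : ℤ) : ℚ)
          = ((d : ℚ) / c - round ((d : ℚ) / c)) * c := by
        push_cast; field_simp; ring
      have h3 : (2 : ℚ) * |((-(round ((d : ℚ) / c)) * c + d : ℤ) : ℚ)| ≤ |(c : ℚ)| := by
        rw [h2, abs_mul]
        nlinarith [abs_nonneg (c : ℚ)]
      exact_mod_cast h3
    set d' := k * c + d with hd'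
    have hd'0 : d' % 2 = 1 := by
      have : c % 4 = 0 := hmod.2.2
      obtain ⟨e, he⟩ : ∃ e, c = 4 * e := ⟨c / 4, by omega⟩
      have : d' = 2 * (2 * (k * e)) + d := by rw [hd', he]; ring
      omega
    obtain ⟨l, hl⟩ : ∃ l : ℤ, |l * (4 * d') + c| ≤ 2 * |d'| := by
      refine ⟨-(round ((c : ℚ) / (4 * d'))), ?_⟩
      have h := abs_sub_round ((c : ℚ) / (4 * d'))
      have hcq : (d' : ℚ) ≠ 0 := by
        have : d' ≠ 0 := by omega
        exact_mod_cast this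
      have h2 : ((-(round ((c : ℚ) / (4 * d'))) * (4 * d') + c : ℤ) : ℚ)
          = ((c : ℚ) / (4 * d') - round ((c : ℚ) / (4 * d'))) * (4 * d') := by
        push_cast; field_simp; ring
      have h3 : |((-(round ((c : ℚ) / (4 * d'))) * (4 * d') + c : ℤ) : ℚ)| ≤ 2 * |(d' : ℚ)| := by
        rw [h2, abs_mul, abs_mul]
        norm_num
        nlinarith [abs_nonneg (d' : ℚ)]
      exact_mod_cast h3
    set γ' := γ * ModularGroup.T ^ k * lowerUnipotent l with hγ'
    have hmem : γ' ∈ CongruenceSubgroup.Gamma1 4 :=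
      mul_mem (mul_mem hγ (T_zpow_mem k)) (lowerUnipotent_mem l)
    have hc' : γ' 1 0 = l * (4 * d') + c := by
      have : (γ' : Matrix (Fin 2) (Fin 2) ℤ)
          = γ * !![1, k; 0, 1] * !![1, 0; 4 * l, 1] := by
        rw [hγ', Matrix.SpecialLinearGroup.coe_mul, Matrix.SpecialLinearGroup.coe_mul,
          ModularGroup.coe_T_zpow]
        rfl
      change (γ' : Matrix (Fin 2) (Fin 2) ℤ) 1 0 = _
      rw [this, Matrix.mul_apply, Fin.sum_univ_two, Matrix.mul_apply, Matrix.mul_apply,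
        Fin.sum_univ_two, Fin.sum_univ_two]
      change (c * 1 + d * 0) * 1 + (c * k + d * 1) * (4 * l) = _
      rw [hd']
      ring
    have hlt : (γ' 1 0).natAbs < n := by
      have : c % 4 = 0 := hmod.2.2
      rw [hc', ← hn]
      rw [Int.abs_eq_natAbs, Int.abs_eq_natAbs] at hk hl
      generalize l * (4 * d') + c = c' at hl ⊢
      omega
    have h1 := ih _ hlt hmem ((lowerUnipotent l)⁻¹ • (ModularGroup.T ^ k)⁻¹ • τ) rfl
    rw [hγ', mul_smul, smul_inv_smul, mul_smul, smul_inv_smul] at h1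
    rw [h1]
    have h2 := hauptmodul_lowerUnipotent_smul l ((lowerUnipotent l)⁻¹ • (ModularGroup.T ^ k)⁻¹ • τ)
    rw [smul_inv_smul] at h2
    rw [← h2]
    have h3 := hauptmodul_T_zpow_smul k ((ModularGroup.T ^ k)⁻¹ • τ)
    rw [smul_inv_smul] at h3
    exact h3.symm

/-! ### Real values on the boundary -/

lemma ofReal_lam {x : ℝ} (hx : ‖(x : ℂ)‖ < 1) :
    ∃ r : ℝ, lam x = ((1 - r ^ 4 : ℝ) : ℂ) ∧ |r| * ‖theta x‖ = ‖theta (-x)‖ := by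
  have hreal : ∀ y : ℝ, ∃ t : ℝ, theta y = t := fun y => by
    have h := theta_conj (y : ℂ)
    rw [conj_ofReal] at h
    exact ⟨_, (conj_eq_iff_real.1 h.symm).choose_spec⟩
  obtain ⟨a, ha⟩ := hreal x
  obtain ⟨b, hb⟩ := hreal (-x)
  push_cast at hb
  have ha0 := theta_ne_zero hx
  refine ⟨b / a, ?_, ?_⟩
  · rw [lam, ha, hb]; push_cast; ring
  · have ha0' : a ≠ 0 := by rintro rfl; simp [ha] at ha0
    rw [ha, hb, norm_real, norm_real, Real.norm_eq_abs, Real.norm_eq_abs, abs_div]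
    have := abs_pos.2 ha0'
    field_simp

/-- On the positive axis `|θ(-x)| ≤ θ(x)`, so that `λ` takes its values in `(0, 1)`. -/
lemma lam_of_pos {x : ℝ} (h0 : 0 < x) (h1 : x < 1) :
    ∃ y : ℝ, 0 < y ∧ y < 1 ∧ lam x = y := by
  have hx : ‖(x : ℂ)‖ < 1 := by rwa [norm_real, Real.norm_of_nonneg h0.le]
  obtain ⟨r, hr, hr1⟩ := ofReal_lam hx
  have hle : ‖theta (-x : ℂ)‖ ≤ ‖theta (x : ℂ)‖ := by
    have := norm_theta_le (q := (-x : ℂ)) (by rwa [norm_neg])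
    rwa [norm_neg, norm_real, Real.norm_of_nonneg h0.le] at this
  have ha0 := norm_pos_iff.2 (theta_ne_zero hx)
  have hb0 := norm_pos_iff.2 (theta_neg_ne_zero hx)
  have hrle : |r| ≤ 1 := by
    by_contra h
    push Not at h
    nlinarith
  have hr0 : 0 < |r| := by
    by_contra h
    have : |r| = 0 := le_antisymm (not_lt.1 h) (abs_nonneg r)
    rw [this] at hr1
    linarith
  have hl0 := lam_ne_zero hx (by exact_mod_cast h0.ne')
  have e : r ^ 4 = |r| ^ 4 := (Even.pow_abs ⟨2, rfl⟩ r).symm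
  rw [e] at hr
  refine ⟨1 - |r| ^ 4, ?_, ?_, hr⟩
  · have h1 : |r| ^ 4 ≤ 1 := pow_le_one₀ hr0.le hrle
    rcases h1.lt_or_eq with h | h
    · linarith
    · rw [hr, h] at hl0; simp at hl0
  · have := pow_pos hr0 4
    linarith

lemma lam_of_neg {x : ℝ} (h0 : 0 < x) (h1 : x < 1) :
    ∃ y : ℝ, y < 0 ∧ lam (-x) = y := by
  have hx : ‖(x : ℂ)‖ < 1 := by rwa [norm_real, Real.norm_of_nonneg h0.le]
  obtain ⟨y, hy0, hy1, hy⟩ := lam_of_pos h0 h1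
  have h := one_sub_lam_mul hx
  rw [hy] at h
  refine ⟨1 - 1 / (1 - y), ?_, ?_⟩
  · rw [sub_neg, lt_div_iff₀ (by linarith)]; linarith
  · have : (1 : ℂ) - y ≠ 0 := by
      have : 1 - y ≠ 0 := by linarith
      exact_mod_cast this
    push_cast
    field_simp
    linear_combination -h

lemma norm_nome_pos (τ : ℂ) : 0 < ‖nome τ‖ := norm_pos_iff.2 (nome_ne_zero τ)

lemma nome_of_re_eq_zero {τ : ℂ} (h : τ.re = 0) : nome τ = ‖nome τ‖ := by
  rw [norm_nome, nome, ofReal_exp]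
  congr 1
  apply Complex.ext <;> simp [h]

lemma nome_of_re_eq_half {τ : ℂ} (h : τ.re = 1 / 2) : nome τ = -‖nome τ‖ := by
  have h1 := nome_add_half (τ - 1 / 2)
  rw [sub_add_cancel] at h1
  rw [h1, norm_neg]
  congr 1
  refine nome_of_re_eq_zero ?_
  simp [h]

lemma hauptmodul_of_re_eq_zero {τ : ℂ} (hτ : 0 < τ.im) (h : τ.re = 0) :
    ∃ y : ℝ, y < 0 ∧ hauptmodul τ = y := by
  rw [hauptmodul, nome_of_re_eq_zero h]
  exact lam_of_neg (norm_nome_pos τ) (norm_nome_lt_one hτ)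

lemma hauptmodul_of_re_eq_half {τ : ℂ} (hτ : 0 < τ.im) (h : τ.re = 1 / 2) :
    ∃ y : ℝ, 0 < y ∧ y < 1 ∧ hauptmodul τ = y := by
  rw [hauptmodul, nome_of_re_eq_half h, neg_neg]
  exact lam_of_pos (norm_nome_pos τ) (norm_nome_lt_one hτ)

/-- The involution `τ ↦ -1/(4τ)` maps the circle `|τ - 1/4| = 1/4` to the line `Re τ = -1/2`. -/
lemma hauptmodul_of_semicircle {τ : ℂ} (hτ : 0 < τ.im) (h : normSq τ = τ.re / 2) :
    ∃ y : ℝ, 1 < y ∧ hauptmodul τ = y := by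
  have hn := normSq_pos.2 (ne_zero_of_im_pos hτ)
  have hre : (fricke τ + (1 : ℤ)).re = 1 / 2 := by
    rw [add_re, fricke_re, intCast_re, h]
    rw [h] at hn
    have : τ.re ≠ 0 := by intro h; rw [h] at hn; simp at hn
    push_cast
    field_simp
    norm_num
  obtain ⟨y, hy0, hy1, hy⟩ := hauptmodul_of_re_eq_half
    (by rw [add_im, intCast_im, add_zero]; exact fricke_im_pos hτ) hre
  rw [hauptmodul_add_int, hauptmodul_fricke hτ] at hy
  refine ⟨y⁻¹, (one_lt_inv₀ hy0).2 hy1, ?_⟩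
  push_cast
  rw [← hy, inv_inv]

/-! ### Local behaviour -/

lemma differentiableOn_hauptmodul : DifferentiableOn ℂ hauptmodul halfPlane := fun _ hτ =>
  (hasDerivAt_hauptmodul hτ).differentiableAt.differentiableWithinAt

lemma isOpen_halfPlane : IsOpen halfPlane := isOpen_lt continuous_const continuous_im

lemma hasStrictDerivAt_hauptmodul {τ : ℂ} (hτ : 0 < τ.im) :
    HasStrictDerivAt hauptmodul (deriv hauptmodul τ) τ :=
  (differentiableOn_hauptmodul.analyticAt (isOpen_halfPlane.mem_nhds hτ)).hasStrictDerivAt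

lemma continuousAt_hauptmodul {τ : ℂ} (hτ : 0 < τ.im) : ContinuousAt hauptmodul τ :=
  (hasDerivAt_hauptmodul hτ).continuousAt

lemma image_hauptmodul_mem_nhds {τ : ℂ} (hτ : 0 < τ.im) {U : Set ℂ} (hU : U ∈ 𝓝 τ) :
    hauptmodul '' U ∈ 𝓝 (hauptmodul τ) := by
  rw [← (hasStrictDerivAt_hauptmodul hτ).map_nhds_eq (deriv_hauptmodul_ne_zero hτ)]
  exact image_mem_map hU

lemma exists_injOn_hauptmodul {τ : ℂ} (hτ : 0 < τ.im) : ∃ U ∈ 𝓝 τ, Set.InjOn hauptmodul U := by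
  have h := (hasStrictDerivAt_hauptmodul hτ).eventually_left_inverse
    (deriv_hauptmodul_ne_zero hτ)
  refine ⟨_, h, fun x hx y hy hxy => ?_⟩
  have hx' := Set.mem_ofPred_eq ▸ hx
  have hy' := Set.mem_ofPred_eq ▸ hy
  rw [← hx', hxy, hy']

/-- Near `0`, the elliptic modulus is injective and has imaginary part of the same sign as `q`,
because `λ'(0) = 16` is a strict derivative. -/
lemma exists_lam_approx : ∃ r > 0, ∀ x y : ℂ, ‖x‖ < r → ‖y‖ < r →
    ‖lam x - lam y - 16 * (x - y)‖ ≤ 8 * ‖x - y‖ := by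
  have hd : DifferentiableOn ℂ lam (Metric.ball 0 1) := fun q hq =>
    (differentiableAt_lam (mem_ball_zero_iff.1 hq)).differentiableWithinAt
  have h := (hd.analyticAt (Metric.isOpen_ball.mem_nhds (by simp : (0 : ℂ) ∈ _))).hasStrictDerivAt
  rw [hasDerivAt_lam_zero.deriv] at h
  have h2 := h.hasStrictFDerivAt.isLittleO.def (c := 8) (by norm_num)
  rw [nhds_prod_eq] at h2
  obtain ⟨t, ht, ht2⟩ := eventually_prod_self_iff'.1 h2
  obtain ⟨r, hr, hr2⟩ := Metric.mem_nhds_iff.1 ht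
  refine ⟨r, hr, fun x y hx hy => ?_⟩
  have := ht2 x (hr2 (by simpa using hx)) y (hr2 (by simpa using hy))
  simpa [mul_comm] using this

lemma lam_injOn_of_approx {x y : ℂ} (h : ‖lam x - lam y - 16 * (x - y)‖ ≤ 8 * ‖x - y‖)
    (hxy : lam x = lam y) : x = y := by
  rw [hxy, sub_self, zero_sub, norm_neg, norm_mul] at h
  norm_num at h
  have := norm_nonneg (x - y)
  exact sub_eq_zero.1 (norm_eq_zero.1 (by linarith))

lemma im_lam_neg_of_approx {x : ℂ}
    (h : ‖lam x - lam (starRingEnd ℂ x) - 16 * (x - starRingEnd ℂ x)‖ ≤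
      8 * ‖x - starRingEnd ℂ x‖) (hx : x.im < 0) : (lam x).im < 0 := by
  rw [lam_conj, sub_conj, sub_conj, show ((2 * (lam x).im : ℝ) : ℂ) * I
    - 16 * (((2 * x.im : ℝ) : ℂ) * I) = ((2 * (lam x).im - 32 * x.im : ℝ) : ℂ) * I by
      push_cast; ring, norm_mul, norm_mul, norm_I, mul_one, mul_one, norm_real, norm_real,
    Real.norm_eq_abs, Real.norm_eq_abs, abs_of_neg (by linarith : 2 * x.im < 0)] at h
  have := le_abs_self (2 * (lam x).im - 32 * x.im)
  linarith

lemma exists_norm_nome_lt {δ : ℝ} (hδ : 0 < δ) : ∃ M : ℝ, ∀ τ : ℂ, M < τ.im → ‖nome τ‖ < δ := by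
  refine ⟨|Real.log δ|, fun τ h => ?_⟩
  rw [norm_nome, ← Real.lt_log_iff_exp_lt hδ]
  have h0 : 0 < τ.im := (abs_nonneg _).trans_lt h
  have h1 := neg_abs_le (Real.log δ)
  nlinarith [Real.pi_gt_three]

lemma exists_norm_hauptmodul_lt {ε : ℝ} (hε : 0 < ε) :
    ∃ M : ℝ, ∀ τ : ℂ, M < τ.im → ‖hauptmodul τ‖ < ε := by
  have h := hasDerivAt_lam_zero.continuousAt.tendsto
  rw [lam_zero] at h
  obtain ⟨δ, hδ, h2⟩ := Metric.tendsto_nhds_nhds.1 h ε hε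
  obtain ⟨M, hM⟩ := exists_norm_nome_lt hδ
  exact ⟨M, fun τ hτ => by
    rw [hauptmodul]; simpa using h2 (x := -nome τ) (by simpa using hM τ hτ)⟩

lemma nome_im (τ : ℂ) : (nome τ).im = ‖nome τ‖ * Real.sin (2 * Real.pi * τ.re) := by
  rw [norm_nome, nome, exp_im]
  simp

lemma nome_im_pos {τ : ℂ} (h0 : 0 < τ.re) (h1 : τ.re < 1 / 2) : 0 < (nome τ).im := by
  rw [nome_im]
  refine mul_pos (norm_nome_pos τ) (Real.sin_pos_of_pos_of_lt_pi ?_ ?_)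
  · have := Real.pi_pos; positivity
  · nlinarith [Real.pi_pos]

lemma eq_of_nome_eq {τ τ' : ℂ} (h : nome τ = nome τ') (hre : |τ.re - τ'.re| < 1) : τ = τ' := by
  obtain ⟨n, hn⟩ := exp_eq_exp_iff_exists_int.1 h
  have h2 : τ = τ' + n := by
    have h3 : (2 * Real.pi * I : ℂ) ≠ 0 := by simp [Real.pi_ne_zero]
    apply mul_left_cancel₀ h3
    rw [hn]; ring
  rw [h2] at hre ⊢
  simp only [add_re, intCast_re, add_sub_cancel_left] at hre
  have : |n| < 1 := by exact_mod_cast hre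
  rw [Int.abs_lt_one_iff.1 this]
  simp

/-! ### Properness of the hauptmodul on the half tile -/

/-- The half of the tile to the left of the line `Re τ = 1/2`: the ideal triangle with vertices
`0`, `1/2` and `i∞`. The condition `|τ - 1/4| > 1/4` is written as `|τ|² > Re τ / 2`. -/
def halfTile : Set ℂ := {τ | 0 < τ.im ∧ 0 < τ.re ∧ τ.re < 1 / 2 ∧ τ.re / 2 < normSq τ}

/-- The closure of `halfTile` in the upper half plane. -/
def closedHalfTile : Set ℂ := {τ | 0 < τ.im ∧ 0 ≤ τ.re ∧ τ.re ≤ 1 / 2 ∧ τ.re / 2 ≤ normSq τ}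

lemma halfTile_subset : halfTile ⊆ closedHalfTile := fun _ h =>
  ⟨h.1, h.2.1.le, h.2.2.1.le, h.2.2.2.le⟩

lemma isOpen_halfTile : IsOpen halfTile := by
  refine (isOpen_lt continuous_const continuous_im).inter
    ((isOpen_lt continuous_const continuous_re).inter
      ((isOpen_lt continuous_re continuous_const).inter (isOpen_lt ?_ continuous_normSq)))
  exact continuous_re.div_const 2

/-- In the half tile, a point close to the real axis is close to one of the cusps `0` and `1/2`,
and is moved up by the corresponding one of `τ ↦ -1/(4τ)` and `τ ↦ -1/(4(τ - 1/2))`. -/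
lemma exists_im_lower_bound (M : ℝ) : ∃ δ > 0, ∀ τ ∈ closedHalfTile,
    (fricke τ).im ≤ M → (fricke (τ - 1 / 2)).im ≤ M → δ ≤ τ.im := by
  obtain ⟨M', hM', hM0⟩ : ∃ M' : ℝ, M ≤ M' ∧ 0 < M' := ⟨max M 1, le_max_left _ _, by positivity⟩
  refine ⟨min 1 (1 / (68 * M')), by positivity, ?_⟩
  rintro τ ⟨h0, h1, h2, h3⟩ h4 h5
  have hn := normSq_pos.2 (ne_zero_of_im_pos h0)
  have him : (τ - 1 / 2).im = τ.im := by simp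
  have hre : (τ - 1 / 2).re = τ.re - 1 / 2 := by simp
  have hn' := normSq_pos.2 (ne_zero_of_im_pos (him ▸ h0 : 0 < (τ - 1 / 2).im))
  rw [fricke_im, div_le_iff₀ (by positivity)] at h4 h5
  rw [normSq_apply] at h3 h4 hn hn'
  rw [normSq_apply, him, hre] at h5
  rw [him, hre] at hn'
  by_contra hlt
  rw [not_le, lt_min_iff, lt_div_iff₀ (by positivity)] at hlt
  obtain ⟨hy1, hy2⟩ := hlt
  set x := τ.re
  set y := τ.im
  -- `s` is the horizontal distance from the nearer one of the two cusps
  have key : ∀ s : ℝ, 0 ≤ s → s ≤ 1 / 4 → s / 4 ≤ y * y → y ≤ M * (4 * (s * s + y * y)) →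
      False := by
    intro s hs hs1 hs2 hs3
    have h6 : s ≤ 4 * (y * y) := by linarith
    have h7 : s * s ≤ 16 * (y * y) := by nlinarith
    have h8 : y ≤ M' * (68 * (y * y)) := by
      refine hs3.trans ?_
      refine (mul_le_mul_of_nonneg_right hM' (by positivity)).trans ?_
      refine mul_le_mul_of_nonneg_left ?_ hM0.le
      linarith
    have : y * (1 - y * (68 * M')) ≤ 0 := by linarith
    nlinarith
  rcases le_total x (1 / 4) with h | h
  · exact key x h1 h (by nlinarith) h4
  · refine key (1 / 2 - x) (by linarith) (by linarith) (by nlinarith) ?_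
    rw [show (1 / 2 - x) * (1 / 2 - x) = (x - 1 / 2) * (x - 1 / 2) by ring]
    exact h5

/-- Values away from `0` are not taken near the cusp `i∞`. -/
lemma exists_im_le {w : ℂ} (hw : w ≠ 0) :
    ∃ M : ℝ, ∀ᶠ z in 𝓝 w, ∀ τ : ℂ, hauptmodul τ = z → τ.im ≤ M := by
  obtain ⟨M, hM⟩ := exists_norm_hauptmodul_lt (half_pos (norm_pos_iff.2 hw))
  refine ⟨M, ?_⟩
  have h : ∀ᶠ z in 𝓝 w, ‖w‖ / 2 < ‖z‖ :=
    continuous_norm.continuousAt.eventually_const_lt (half_lt_self (norm_pos_iff.2 hw))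
  filter_upwards [h] with z hz τ hτ
  by_contra hlt
  have := hM τ (not_le.1 hlt)
  rw [hτ] at this
  linarith

lemma hauptmodul_fricke_sub_half {τ : ℂ} (hτ : 0 < τ.im) :
    hauptmodul τ * (1 - hauptmodul (fricke (τ - 1 / 2))) = 1 := by
  have him : 0 < (τ - 1 / 2).im := by simpa using hτ
  have h1 := one_sub_hauptmodul_add_half him
  rw [sub_add_cancel] at h1
  have h0 := hauptmodul_ne_zero him
  rw [hauptmodul_fricke him]
  generalize hauptmodul (τ - 1 / 2) = z at h0 h1 ⊢
  field_simp
  linear_combination h1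

/-- Values away from `1` and `∞` are not taken near the cusps `0` and `1/2`. -/
lemma exists_im_fricke_le {w : ℂ} (hw : w ≠ 1) :
    ∃ M : ℝ, ∀ᶠ z in 𝓝 w, ∀ τ : ℂ, 0 < τ.im → hauptmodul τ = z →
      (fricke τ).im ≤ M ∧ (fricke (τ - 1 / 2)).im ≤ M := by
  have hw1 : 0 < ‖w - 1‖ := norm_pos_iff.2 (sub_ne_zero.2 hw)
  have hw2 : 0 < ‖w‖ + 1 := by positivity
  set ε := min (1 / (‖w‖ + 1)) (‖w - 1‖ / 2 / (‖w‖ + 1)) with hε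
  have hε0 : 0 < ε := by positivity
  obtain ⟨M, hM⟩ := exists_norm_hauptmodul_lt hε0
  refine ⟨M, ?_⟩
  have h1 : ∀ᶠ z in 𝓝 w, ‖z‖ < ‖w‖ + 1 :=
    continuous_norm.continuousAt.eventually_lt_const (lt_add_one _)
  have h2 : ∀ᶠ z in 𝓝 w, ‖w - 1‖ / 2 < ‖z - 1‖ :=
    (continuous_norm.comp (continuous_sub_right 1)).continuousAt.eventually_const_lt
      (half_lt_self hw1)
  filter_upwards [h1, h2] with z hz1 hz2 τ hτ hz
  have hz0 : 0 < ‖z‖ := by rw [← hz]; exact norm_pos_iff.2 (hauptmodul_ne_zero hτ)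
  constructor
  · by_contra hlt
    have h := hM _ (not_le.1 hlt)
    rw [hauptmodul_fricke hτ, hz, norm_inv] at h
    have h3 := h.trans_le (min_le_left _ _)
    rw [one_div] at h3
    exact absurd ((inv_lt_inv₀ hz0 hw2).1 h3) (not_lt.2 hz1.le)
  · by_contra hlt
    have h := hM _ (not_le.1 hlt)
    have h3 := hauptmodul_fricke_sub_half hτ
    rw [hz] at h3
    have h4 : z * hauptmodul (fricke (τ - 1 / 2)) = z - 1 := by linear_combination -h3
    have h5 : ‖z‖ * ‖hauptmodul (fricke (τ - 1 / 2))‖ = ‖z - 1‖ := by rw [← norm_mul, h4]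
    have h6 := h.trans_le (min_le_right _ _)
    rw [lt_div_iff₀ hw2] at h6
    have h7 : ‖z‖ * ‖hauptmodul (fricke (τ - 1 / 2))‖ ≤
        (‖w‖ + 1) * ‖hauptmodul (fricke (τ - 1 / 2))‖ :=
      mul_le_mul_of_nonneg_right hz1.le (norm_nonneg _)
    linarith

lemma isCompact_truncated (δ M : ℝ) :
    IsCompact {τ : ℂ | δ ≤ τ.im ∧ τ.im ≤ M ∧ 0 ≤ τ.re ∧ τ.re ≤ 1 / 2 ∧ τ.re / 2 ≤ normSq τ} := by
  have hc : IsCompact ((Set.Icc (0 : ℝ) (1 / 2)) ×ℂ (Set.Icc δ M)) :=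
    isCompact_Icc.reProdIm isCompact_Icc
  refine hc.of_isClosed_subset ?_ ?_
  · refine (isClosed_le continuous_const continuous_im).inter
      ((isClosed_le continuous_im continuous_const).inter
      ((isClosed_le continuous_const continuous_re).inter
      ((isClosed_le continuous_re continuous_const).inter (isClosed_le ?_ continuous_normSq))))
    exact continuous_re.div_const 2
  · rintro τ ⟨h1, h2, h3, h4, -⟩
    exact ⟨⟨h3, h4⟩, ⟨h1, h2⟩⟩

lemma exists_subseq_of_im_le {u : ℕ → ℂ} {w : ℂ} {M : ℝ} (hu : ∀ n, u n ∈ closedHalfTile)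
    (hlim : Tendsto (fun n => hauptmodul (u n)) atTop (𝓝 w)) (hw : w ≠ 1)
    (hM : ∃ᶠ n in atTop, (u n).im ≤ M) :
    ∃ τ ∈ closedHalfTile, hauptmodul τ = w ∧
      ∃ φ : ℕ → ℕ, StrictMono φ ∧ Tendsto (u ∘ φ) atTop (𝓝 τ) := by
  obtain ⟨M', hM'⟩ := exists_im_fricke_le hw
  obtain ⟨δ, hδ, hδ2⟩ := exists_im_lower_bound M'
  have hfreq : ∃ᶠ n in atTop, u n ∈
      {τ : ℂ | δ ≤ τ.im ∧ τ.im ≤ M ∧ 0 ≤ τ.re ∧ τ.re ≤ 1 / 2 ∧ τ.re / 2 ≤ normSq τ} := by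
    refine (hM.and_eventually (hlim.eventually hM')).mono fun n hn => ?_
    have := hn.2 (u n) (hu n).1 rfl
    exact ⟨hδ2 _ (hu n) this.1 this.2, hn.1, (hu n).2⟩
  obtain ⟨τ, hτ, φ, hφ, hφ2⟩ := (isCompact_truncated δ M).tendsto_subseq' hfreq
  have him : 0 < τ.im := hδ.trans_le hτ.1
  refine ⟨τ, ⟨him, hτ.2.2⟩, ?_, φ, hφ, hφ2⟩
  exact tendsto_nhds_unique ((continuousAt_hauptmodul him).tendsto.comp hφ2)
    (hlim.comp hφ.tendsto_atTop)

/-- Properness of the hauptmodul as a map from the closed half tile to `ℂ ∖ {0, 1}`. -/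
lemma exists_subseq {u : ℕ → ℂ} {w : ℂ} (hu : ∀ n, u n ∈ closedHalfTile)
    (hlim : Tendsto (fun n => hauptmodul (u n)) atTop (𝓝 w)) (hw0 : w ≠ 0) (hw : w ≠ 1) :
    ∃ τ ∈ closedHalfTile, hauptmodul τ = w ∧
      ∃ φ : ℕ → ℕ, StrictMono φ ∧ Tendsto (u ∘ φ) atTop (𝓝 τ) := by
  obtain ⟨M, hM⟩ := exists_im_le hw0
  exact exists_subseq_of_im_le hu hlim hw
    ((hlim.eventually hM).mono fun n hn => hn (u n) rfl).frequently

/-- In the half tile, the value `0` is only approached at the cusp `i∞`. -/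
lemma tendsto_nome_zero {u : ℕ → ℂ} (hu : ∀ n, u n ∈ closedHalfTile)
    (hlim : Tendsto (fun n => hauptmodul (u n)) atTop (𝓝 0)) :
    Tendsto (fun n => nome (u n)) atTop (𝓝 0) := by
  rw [Metric.tendsto_nhds]
  intro ε hε
  obtain ⟨M, hM⟩ := exists_norm_nome_lt hε
  have : ∀ᶠ n in atTop, ¬ (u n).im ≤ M := by
    rw [← not_frequently]
    intro h
    obtain ⟨τ, hτ, hτ2, -⟩ := exists_subseq_of_im_le hu hlim zero_ne_one h
    exact hauptmodul_ne_zero hτ.1 hτ2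
  filter_upwards [this] with n hn
  simpa using hM _ (not_le.1 hn)

/-! ### The half tile is mapped bijectively onto the lower half plane -/

lemma mem_halfTile_of_im_ne_zero {τ : ℂ} (hτ : τ ∈ closedHalfTile) (h : (hauptmodul τ).im ≠ 0) :
    τ ∈ halfTile := by
  obtain ⟨h0, h1, h2, h3⟩ := hτ
  refine ⟨h0, h1.lt_of_ne ?_, h2.lt_of_ne ?_, h3.lt_of_ne ?_⟩
  · intro h4
    obtain ⟨y, -, hy⟩ := hauptmodul_of_re_eq_zero h0 h4.symm
    simp [hy] at h
  · intro h4
    obtain ⟨y, -, -, hy⟩ := hauptmodul_of_re_eq_half h0 h4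
    simp [hy] at h
  · intro h4
    obtain ⟨y, -, hy⟩ := hauptmodul_of_semicircle h0 h4.symm
    simp [hy] at h

lemma isOpen_image_halfTile : IsOpen (hauptmodul '' halfTile) := by
  rw [isOpen_iff_mem_nhds]
  rintro _ ⟨τ, hτ, rfl⟩
  exact image_hauptmodul_mem_nhds hτ.1 (isOpen_halfTile.mem_nhds hτ)

lemma ne_of_im_ne_zero {w : ℂ} (h : w.im ≠ 0) : w ≠ 0 ∧ w ≠ 1 :=
  ⟨by rintro rfl; simp at h, by rintro rfl; simp at h⟩

/-- The image of the half tile is closed outside of the real line. -/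
lemma mem_image_halfTile_of_mem_closure {w : ℂ} (hw : w ∈ closure (hauptmodul '' halfTile))
    (him : w.im ≠ 0) : w ∈ hauptmodul '' halfTile := by
  obtain ⟨v, hv, hlim⟩ := mem_closure_iff_seq_limit.1 hw
  choose u hu huv using hv
  obtain ⟨τ, hτ, hτw, -⟩ := exists_subseq (fun n => halfTile_subset (hu n))
    (by simpa [huv] using hlim) (ne_of_im_ne_zero him).1 (ne_of_im_ne_zero him).2
  exact ⟨τ, mem_halfTile_of_im_ne_zero hτ (by rwa [hτw]), hτw⟩

lemma isPreconnected_upper : IsPreconnected {w : ℂ | 0 < w.im} :=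
  (convex_halfSpace_im_gt 0).isPreconnected

lemma isPreconnected_lower : IsPreconnected {w : ℂ | w.im < 0} :=
  (convex_halfSpace_im_lt 0).isPreconnected

lemma tendsto_ofReal_mul_I (c : ℝ) :
    Tendsto (fun n : ℕ => ((c * (1 / ((n : ℝ) + 1)) : ℝ) : ℂ) * I) atTop (𝓝 0) := by
  have h1 := (tendsto_one_div_add_atTop_nhds_zero_nat (𝕜 := ℝ)).const_mul c
  have h2 := ((continuous_ofReal.tendsto _).comp h1).mul_const I
  simpa using h2

/-- If some value in the upper half plane was attained, all of them would be, in particular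
small ones. But these are attained only close to `i∞`, where `-16q` is a good approximation. -/
lemma not_im_pos {τ : ℂ} (hτ : τ ∈ halfTile) : ¬ 0 < (hauptmodul τ).im := by
  intro hpos
  have hsub : {w : ℂ | 0 < w.im} ⊆ hauptmodul '' halfTile :=
    isPreconnected_upper.subset_of_closure_inter_subset isOpen_image_halfTile
      ⟨_, hpos, τ, hτ, rfl⟩
      (fun w hw => mem_image_halfTile_of_mem_closure hw.1 (ne_of_gt hw.2))
  have hex : ∀ n : ℕ, ∃ t ∈ halfTile, hauptmodul t = ((1 * (1 / ((n : ℝ) + 1)) : ℝ) : ℂ) * I := by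
    intro n
    refine hsub ?_
    have : (0 : ℝ) < 1 * (1 / ((n : ℝ) + 1)) := by positivity
    simpa only [Set.mem_ofPred_eq, mul_I_im, ofReal_re] using this
  choose u hu huv using hex
  have hlim : Tendsto (fun n => hauptmodul (u n)) atTop (𝓝 0) := by
    simp only [huv]; exact tendsto_ofReal_mul_I 1
  have hn := tendsto_nome_zero (fun n => halfTile_subset (hu n)) hlim
  obtain ⟨r, hr, happ⟩ := exists_lam_approx
  obtain ⟨n, hn⟩ := (hn.eventually (Metric.ball_mem_nhds 0 hr)).exists
  rw [dist_zero_right] at hn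
  have h1 := im_lam_neg_of_approx (x := -nome (u n))
    (happ _ _ (by rwa [norm_neg]) (by rwa [RCLike.norm_conj, norm_neg]))
    (by rw [neg_im]; linarith [nome_im_pos (hu n).2.1 (hu n).2.2.1])
  have h2 : (lam (-nome (u n))).im = 1 * (1 / ((n : ℝ) + 1)) := by
    have := congrArg im (huv n)
    rwa [mul_I_im, ofReal_re] at this
  rw [h2] at h1
  have : (0 : ℝ) < 1 * (1 / ((n : ℝ) + 1)) := by positivity
  linarith

lemma im_hauptmodul_neg {τ : ℂ} (hτ : τ ∈ halfTile) : (hauptmodul τ).im < 0 := by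
  rcases lt_trichotomy (hauptmodul τ).im 0 with h | h | h
  · exact h
  · exfalso
    -- the image is open, so a real value would have values in the upper half plane next to it
    have h1 := isOpen_image_halfTile.mem_nhds ⟨τ, hτ, rfl⟩
    have h2 : Tendsto (fun n : ℕ => hauptmodul τ + ((1 * (1 / ((n : ℝ) + 1)) : ℝ) : ℂ) * I) atTop
        (𝓝 (hauptmodul τ)) := by
      simpa using (tendsto_ofReal_mul_I 1).const_add (hauptmodul τ)
    obtain ⟨n, t, ht, htn⟩ := (h2.eventually h1).exists
    refine not_im_pos ht ?_
    rw [htn, add_im, h, mul_I_im, ofReal_re, zero_add]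
    positivity
  · exact absurd h (not_im_pos hτ)

lemma halfTile_nonempty : halfTile.Nonempty := by
  refine ⟨⟨1 / 4, 1⟩, ?_, ?_, ?_, ?_⟩ <;> norm_num [normSq_apply]

lemma image_halfTile : hauptmodul '' halfTile = {w : ℂ | w.im < 0} := by
  refine Set.Subset.antisymm ?_ ?_
  · rintro _ ⟨τ, hτ, rfl⟩
    exact im_hauptmodul_neg hτ
  · obtain ⟨τ, hτ⟩ := halfTile_nonempty
    exact isPreconnected_lower.subset_of_closure_inter_subset isOpen_image_halfTile
      ⟨_, im_hauptmodul_neg hτ, τ, hτ, rfl⟩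
      (fun w hw => mem_image_halfTile_of_mem_closure hw.1 (ne_of_lt hw.2))

/-- The set of the values taken more than once is open and closed in the lower half plane, and
does not contain values close to `0`. -/
lemma injOn_halfTile : Set.InjOn hauptmodul halfTile := by
  set S : Set ℂ := {w | ∃ τ ∈ halfTile, ∃ τ' ∈ halfTile, τ ≠ τ' ∧ hauptmodul τ = w ∧
    hauptmodul τ' = w} with hS
  intro τ₁ h₁ τ₂ h₂ heq
  by_contra hne
  have hopen : IsOpen S := by
    rw [isOpen_iff_mem_nhds]
    rintro _ ⟨τ, hτ, τ', hτ', hne, rfl, hw⟩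
    obtain ⟨U, U', hU, hU', hτU, hτU', hd⟩ := t2_separation hne
    have h1 := image_hauptmodul_mem_nhds hτ.1
      (inter_mem (hU.mem_nhds hτU) (isOpen_halfTile.mem_nhds hτ))
    have h2 := image_hauptmodul_mem_nhds hτ'.1
      (inter_mem (hU'.mem_nhds hτU') (isOpen_halfTile.mem_nhds hτ'))
    rw [hw] at h2
    filter_upwards [h1, h2]
    rintro w ⟨t, ht, htw⟩ ⟨t', ht', htw'⟩
    refine ⟨t, ht.2, t', ht'.2, ?_, htw, htw'⟩
    rintro rfl
    exact Set.disjoint_left.1 hd ht.1 ht'.1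
  have hsub : {w : ℂ | w.im < 0} ⊆ S := by
    refine isPreconnected_lower.subset_of_closure_inter_subset hopen
      ⟨_, im_hauptmodul_neg h₁, τ₁, h₁, τ₂, h₂, hne, rfl, heq.symm⟩ ?_
    rintro w ⟨hw, him⟩
    have him0 : w.im ≠ 0 := ne_of_lt him
    obtain ⟨v, hv, hlim⟩ := mem_closure_iff_seq_limit.1 hw
    choose u hu u' hu' hne huv huv' using hv
    obtain ⟨τ, hτ, hτw, φ, hφ, hlimu⟩ := exists_subseq (fun n => halfTile_subset (hu n))
      (by simpa [huv] using hlim) (ne_of_im_ne_zero him0).1 (ne_of_im_ne_zero him0).2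
    obtain ⟨τ', hτ', hτw', ψ, hψ, hlimu'⟩ := exists_subseq
      (u := fun n => u' (φ n)) (fun n => halfTile_subset (hu' _))
      (by simp only [huv']; exact hlim.comp hφ.tendsto_atTop)
      (ne_of_im_ne_zero him0).1 (ne_of_im_ne_zero him0).2
    refine ⟨τ, mem_halfTile_of_im_ne_zero hτ (by rwa [hτw]), τ',
      mem_halfTile_of_im_ne_zero hτ' (by rwa [hτw']), ?_, hτw, hτw'⟩
    rintro rfl
    obtain ⟨U, hU, hinj⟩ := exists_injOn_hauptmodul hτ.1
    obtain ⟨n, hn, hn'⟩ := (((hlimu.comp hψ.tendsto_atTop).eventually hU).and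
      (hlimu'.eventually hU)).exists
    refine hne (φ (ψ n)) (hinj hn hn' ?_)
    simp only [Function.comp, huv, huv']
  have hex : ∀ n : ℕ, (((-1) * (1 / ((n : ℝ) + 1)) : ℝ) : ℂ) * I ∈ S := by
    intro n
    refine hsub ?_
    have : (0 : ℝ) < 1 / ((n : ℝ) + 1) := by positivity
    rw [Set.mem_ofPred_eq, mul_I_im, ofReal_re]
    linarith
  choose u hu u' hu' hne huv huv' using hex
  have hl := tendsto_nome_zero (fun n => halfTile_subset (hu n))
    (by simp only [huv]; exact tendsto_ofReal_mul_I _)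
  have hl' := tendsto_nome_zero (fun n => halfTile_subset (hu' n))
    (by simp only [huv']; exact tendsto_ofReal_mul_I _)
  obtain ⟨r, hr, happ⟩ := exists_lam_approx
  obtain ⟨n, hn, hn'⟩ := ((hl.eventually (Metric.ball_mem_nhds 0 hr)).and
    (hl'.eventually (Metric.ball_mem_nhds 0 hr))).exists
  rw [dist_zero_right] at hn hn'
  refine hne n (eq_of_nome_eq (neg_injective (lam_injOn_of_approx
    (happ _ _ (by rwa [norm_neg]) (by rwa [norm_neg])) ((huv n).trans (huv' n).symm))) ?_)
  obtain ⟨-, a1, a2, -⟩ := hu n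
  obtain ⟨-, b1, b2, -⟩ := hu' n
  rw [abs_lt]
  constructor <;> linarith

/-! ### The tile is mapped bijectively onto the slit plane -/

/-- The reflection in the axis `Re τ = 1/2` of the tile. -/
noncomputable def reflect (τ : ℂ) : ℂ := 1 - starRingEnd ℂ τ

lemma reflect_re (τ : ℂ) : (reflect τ).re = 1 - τ.re := by simp [reflect]

lemma reflect_im (τ : ℂ) : (reflect τ).im = τ.im := by simp [reflect]

lemma reflect_reflect (τ : ℂ) : reflect (reflect τ) = τ := by simp [reflect]

lemma hauptmodul_reflect (τ : ℂ) : hauptmodul (reflect τ) = starRingEnd ℂ (hauptmodul τ) := by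
  rw [← hauptmodul_neg_conj, ← hauptmodul_add_int (-starRingEnd ℂ τ) 1, reflect]
  congr 1
  push_cast
  ring

/-- The circle `|τ - 1/4| = 1/4` is `|τ|² = Re τ / 2`. -/
lemma quarter_lt_norm_iff (τ : ℂ) : 1 / 4 < ‖τ - 1 / 4‖ ↔ τ.re / 2 < normSq τ := by
  rw [← sq_lt_sq₀ (by norm_num) (norm_nonneg _), ← normSq_eq_norm_sq, normSq_apply, normSq_apply]
  have h1 : (τ - 1 / 4).re = τ.re - 1 / 4 := by
    rw [show (1 / 4 : ℂ) = ((1 / 4 : ℝ) : ℂ) by push_cast; ring, sub_re, ofReal_re]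
  have h2 : (τ - 1 / 4).im = τ.im := by
    rw [show (1 / 4 : ℂ) = ((1 / 4 : ℝ) : ℂ) by push_cast; ring, sub_im, ofReal_im, sub_zero]
  rw [h1, h2]
  constructor <;> intro h <;> linarith

lemma norm_sub_three_quarters (τ : ℂ) : ‖τ - 3 / 4‖ = ‖reflect τ - 1 / 4‖ := by
  rw [← norm_conj (τ - 3 / 4), ← norm_neg, reflect]
  congr 1
  simp only [map_sub, map_div₀, map_ofNat]
  ring

lemma norm_sub_quarter (τ : ℂ) : ‖τ - 1 / 4‖ = ‖reflect τ - 3 / 4‖ := by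
  rw [norm_sub_three_quarters, reflect_reflect]

lemma reflect_mem_extendedTile {τ : ℂ} (h : τ ∈ extendedTile) : reflect τ ∈ extendedTile := by
  obtain ⟨h0, h1, h2, h3, h4⟩ := h
  refine ⟨by rwa [reflect_im], ?_, ?_, ?_, ?_⟩
  · rw [reflect_re]; linarith
  · rw [reflect_re]; linarith
  · rwa [← norm_sub_three_quarters]
  · rwa [← norm_sub_quarter]

lemma quarter_lt_reflect {τ : ℂ} (h0 : 0 < τ.im) (h : τ.re ≤ 1 / 2) : 1 / 4 < ‖τ - 3 / 4‖ := by
  rw [norm_sub_three_quarters, quarter_lt_norm_iff, reflect_re, normSq_apply, reflect_re,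
    reflect_im]
  nlinarith

lemma mem_halfTile_of_mem_extendedTile {τ : ℂ} (h : τ ∈ extendedTile) (hre : τ.re < 1 / 2) :
    τ ∈ halfTile :=
  ⟨h.1, h.2.1, hre, (quarter_lt_norm_iff τ).1 h.2.2.2.1⟩

lemma mem_extendedTile_of_mem_halfTile {τ : ℂ} (h : τ ∈ halfTile) : τ ∈ extendedTile := by
  obtain ⟨h0, h1, h2, h3⟩ := h
  exact ⟨h0, h1, by linarith, (quarter_lt_norm_iff τ).2 h3, quarter_lt_reflect h0 h2.le⟩

lemma mem_extendedTile_of_re_eq_half {τ : ℂ} (h0 : 0 < τ.im) (h : τ.re = 1 / 2) :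
    τ ∈ extendedTile := by
  refine ⟨h0, by rw [h]; norm_num, by rw [h]; norm_num, ?_, quarter_lt_reflect h0 h.le⟩
  rw [quarter_lt_norm_iff, normSq_apply, h]
  nlinarith

lemma isOpen_extendedTile : IsOpen extendedTile := by
  have h : ∀ c : ℂ, IsOpen {τ : ℂ | 1 / 4 < ‖τ - c‖} := fun c =>
    isOpen_lt continuous_const (continuous_sub_right c).norm
  exact (isOpen_lt continuous_const continuous_im).inter
    ((isOpen_lt continuous_const continuous_re).inter
      ((isOpen_lt continuous_re continuous_const).inter ((h _).inter (h _))))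

lemma extendedTile_subset : extendedTile ⊆ halfPlane := fun _ h => h.1

/-- The three parts of the tile are mapped to the lower half plane, the interval `(0, 1)` and the
upper half plane. -/
lemma extendedTile_cases {τ : ℂ} (h : τ ∈ extendedTile) :
    (τ ∈ halfTile ∧ (hauptmodul τ).im < 0) ∨
    (τ.re = 1 / 2 ∧ ∃ y : ℝ, 0 < y ∧ y < 1 ∧ hauptmodul τ = y) ∨
    (reflect τ ∈ halfTile ∧ 0 < (hauptmodul τ).im) := by
  rcases lt_trichotomy τ.re (1 / 2) with h1 | h1 | h1
  · have := mem_halfTile_of_mem_extendedTile h h1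
    exact Or.inl ⟨this, im_hauptmodul_neg this⟩
  · exact Or.inr (Or.inl ⟨h1, hauptmodul_of_re_eq_half h.1 h1⟩)
  · have hr : reflect τ ∈ halfTile := mem_halfTile_of_mem_extendedTile (reflect_mem_extendedTile h)
      (by rw [reflect_re]; linarith)
    refine Or.inr (Or.inr ⟨hr, ?_⟩)
    have := im_hauptmodul_neg hr
    rw [hauptmodul_reflect, conj_im] at this
    linarith

lemma mapsTo_extendedTile : Set.MapsTo hauptmodul extendedTile slitDomain := by
  intro τ hτ h
  rcases extendedTile_cases hτ with ⟨-, h1⟩ | ⟨-, y, hy0, hy1, hy⟩ | ⟨-, h1⟩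
  · exact h1.ne h.1
  · rw [hy, ofReal_re] at h
    rcases h.2 with h2 | h2 <;> linarith
  · exact h1.ne' h.1

lemma eq_of_im_ne_zero {τ τ' : ℂ} (hτ : τ ∈ extendedTile) (hτ' : τ' ∈ extendedTile)
    (h : hauptmodul τ = hauptmodul τ') (him : (hauptmodul τ).im ≠ 0) : τ = τ' := by
  rcases extendedTile_cases hτ with ⟨h1, h1'⟩ | ⟨-, y, -, -, hy⟩ | ⟨h1, h1'⟩
  · rcases extendedTile_cases hτ' with ⟨h2, h2'⟩ | ⟨-, y, -, -, hy⟩ | ⟨h2, h2'⟩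
    · exact injOn_halfTile h1 h2 h
    · rw [h, hy] at him; simp at him
    · rw [h] at h1'; linarith
  · rw [hy] at him; simp at him
  · rcases extendedTile_cases hτ' with ⟨h2, h2'⟩ | ⟨-, y, -, -, hy⟩ | ⟨h2, h2'⟩
    · rw [h] at h1'; linarith
    · rw [h, hy] at him; simp at him
    · rw [← reflect_reflect τ, ← reflect_reflect τ']
      congr 1
      exact injOn_halfTile h1 h2 (by rw [hauptmodul_reflect, hauptmodul_reflect, h])

/-- Coincidences between values of the hauptmodul can be moved off the real line. -/
lemma frequently_eq_im_ne_zero {τ τ' : ℂ} (hτ : 0 < τ.im) (hτ' : 0 < τ'.im)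
    (h : hauptmodul τ = hauptmodul τ') {U U' : Set ℂ} (hU : U ∈ 𝓝 τ) (hU' : U' ∈ 𝓝 τ') :
    ∃ t ∈ U, ∃ t' ∈ U', hauptmodul t = hauptmodul t' ∧ (hauptmodul t).im ≠ 0 := by
  have h1 := image_hauptmodul_mem_nhds hτ hU
  have h2 := image_hauptmodul_mem_nhds hτ' hU'
  rw [← h] at h2
  have h4 : ∃ᶠ z in 𝓝 (hauptmodul τ), z.im ≠ 0 := by
    have hd : Dense {z : ℂ | z.im ≠ 0} := by
      have := (dense_compl_singleton (0 : ℝ)).preimage isOpenMap_im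
      exact this
    exact mem_closure_iff_frequently.1 (hd _)
  obtain ⟨z, hz, ⟨t, ht, htz⟩, ⟨t', ht', htz'⟩⟩ := (h4.and_eventually (inter_mem h1 h2)).exists
  exact ⟨t, ht, t', ht', htz.trans htz'.symm, by rwa [htz]⟩

lemma injOn_extendedTile : Set.InjOn hauptmodul extendedTile := by
  intro τ hτ τ' hτ' h
  by_contra hne
  obtain ⟨U, U', hU, hU', hτU, hτU', hd⟩ := t2_separation hne
  obtain ⟨t, ht, t', ht', heq, him⟩ := frequently_eq_im_ne_zero hτ.1 hτ'.1 h
    (inter_mem (hU.mem_nhds hτU) (isOpen_extendedTile.mem_nhds hτ))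
    (inter_mem (hU'.mem_nhds hτU') (isOpen_extendedTile.mem_nhds hτ'))
  have := eq_of_im_ne_zero ht.2 ht'.2 heq him
  rw [← this] at ht'
  exact Set.disjoint_left.1 hd ht.1 ht'.1

/-- By properness, the values on the real line are attained on the boundary of the half tile. -/
lemma exists_of_im_eq_zero {w : ℂ} (h : w.im = 0) (h0 : w ≠ 0) (h1 : w ≠ 1) :
    ∃ τ ∈ closedHalfTile, hauptmodul τ = w := by
  have hex : ∀ n : ℕ, ∃ t ∈ halfTile,
      hauptmodul t = w + (((-1) * (1 / ((n : ℝ) + 1)) : ℝ) : ℂ) * I := by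
    intro n
    have hmem : w + (((-1) * (1 / ((n : ℝ) + 1)) : ℝ) : ℂ) * I ∈ {w : ℂ | w.im < 0} := by
      have : (0 : ℝ) < 1 / ((n : ℝ) + 1) := by positivity
      rw [Set.mem_ofPred_eq, add_im, mul_I_im, ofReal_re, h]
      linarith
    rw [← image_halfTile] at hmem
    exact hmem
  choose u hu huw using hex
  obtain ⟨τ, hτ, hτw, -⟩ := exists_subseq (w := w) (fun n => halfTile_subset (hu n))
    (by simp only [huw]; simpa using (tendsto_ofReal_mul_I (-1)).const_add w) h0 h1
  exact ⟨τ, hτ, hτw⟩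

lemma surjOn_extendedTile : Set.SurjOn hauptmodul extendedTile slitDomain := by
  intro w hw
  rcases lt_trichotomy w.im 0 with h | h | h
  · have : w ∈ hauptmodul '' halfTile := by rw [image_halfTile]; exact h
    obtain ⟨τ, hτ, rfl⟩ := this
    exact ⟨τ, mem_extendedTile_of_mem_halfTile hτ, rfl⟩
  · have hre : 0 < w.re ∧ w.re < 1 := by
      constructor
      · by_contra hc; exact hw ⟨h, Or.inl (not_lt.1 hc)⟩
      · by_contra hc; exact hw ⟨h, Or.inr (not_lt.1 hc)⟩
    obtain ⟨τ, ⟨t0, t1, t2, t3⟩, hτw⟩ := exists_of_im_eq_zero h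
      (by rintro rfl; simp at hre) (by rintro rfl; simp at hre)
    refine ⟨τ, ?_, hτw⟩
    rcases t2.lt_or_eq with t2 | t2
    · exfalso
      rcases t1.lt_or_eq with t1 | t1
      · rcases t3.lt_or_eq with t3 | t3
        · have := im_hauptmodul_neg ⟨t0, t1, t2, t3⟩
          rw [hτw, h] at this
          exact lt_irrefl _ this
        · obtain ⟨y, hy, hy'⟩ := hauptmodul_of_semicircle t0 t3.symm
          rw [← hτw, hy', ofReal_re] at hre
          linarith [hre.2]
      · obtain ⟨y, hy, hy'⟩ := hauptmodul_of_re_eq_zero t0 t1.symm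
        rw [← hτw, hy', ofReal_re] at hre
        linarith [hre.1]
    · exact mem_extendedTile_of_re_eq_half t0 t2
  · have : starRingEnd ℂ w ∈ hauptmodul '' halfTile := by
      rw [image_halfTile, Set.mem_ofPred_eq, conj_im]; linarith
    obtain ⟨τ, hτ, hτw⟩ := this
    refine ⟨reflect τ, reflect_mem_extendedTile (mem_extendedTile_of_mem_halfTile hτ), ?_⟩
    rw [hauptmodul_reflect, hτw, conj_conj]

lemma bijOn_extendedTile : Set.BijOn hauptmodul extendedTile slitDomain :=
  ⟨mapsTo_extendedTile, injOn_extendedTile, surjOn_extendedTile⟩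

lemma image_hauptmodul_halfPlane : hauptmodul '' halfPlane = puncturedSphere := by
  refine Set.Subset.antisymm ?_ ?_
  · rintro _ ⟨τ, hτ, rfl⟩
    exact ⟨hauptmodul_ne_zero hτ, hauptmodul_ne_one hτ⟩
  · rintro w ⟨h0, h1⟩
    by_cases h : w.im = 0
    · obtain ⟨τ, hτ, hw⟩ := exists_of_im_eq_zero h h0 h1
      exact ⟨τ, hτ.1, hw⟩
    · obtain ⟨τ, hτ, hw⟩ := surjOn_extendedTile (fun hc => h hc.1 : w ∈ slitDomain)
      exact ⟨τ, hτ.1, hw⟩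

/-! ### The fibres are the orbits of `Γ₁(4)` -/

/-- Among the bottom rows of matrices in `Γ₁(4)`, one minimises `|cτ + d|`; the corresponding
translate of `τ`, moved into the strip `0 ≤ Re τ < 1`, lies in the closure of the tile. -/
lemma exists_smul_mem_closedTile (τ : UpperHalfPlane) :
    ∃ γ ∈ CongruenceSubgroup.Gamma1 4, 0 ≤ (γ • τ).re ∧ (γ • τ).re < 1 ∧
      1 / 4 ≤ ‖((γ • τ : UpperHalfPlane) : ℂ) - 1 / 4‖ ∧
      1 / 4 ≤ ‖((γ • τ : UpperHalfPlane) : ℂ) - 3 / 4‖ := by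
  obtain ⟨g, hg, hmax⟩ : ∃ g ∈ CongruenceSubgroup.Gamma1 4,
      ∀ g' ∈ CongruenceSubgroup.Gamma1 4, (g' • τ).im ≤ (g • τ).im := by
    let s : Set (Fin 2 → ℤ) := {p | ∃ g ∈ CongruenceSubgroup.Gamma1 4, g 1 = p}
    have hs : s.Nonempty := ⟨_, 1, one_mem _, rfl⟩
    obtain ⟨p, ⟨g, hg, hgp⟩, hp⟩ :=
      Filter.Tendsto.exists_within_forall_le hs (ModularGroup.tendsto_normSq_coprime_pair τ)
    refine ⟨g, hg, fun g' hg' => ?_⟩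
    rw [ModularGroup.im_smul_eq_div_normSq, ModularGroup.im_smul_eq_div_normSq,
      div_le_div_iff_of_pos_left]
    · simpa [← hgp] using! hp (g' 1) ⟨g', hg', rfl⟩
    · exact τ.im_pos
    · exact UpperHalfPlane.normSq_denom_pos g' τ.im_ne_zero
    · exact UpperHalfPlane.normSq_denom_pos g τ.im_ne_zero
  set n : ℤ := -⌊(g • τ).re⌋ with hn
  set σ : UpperHalfPlane := (ModularGroup.T ^ n * g) • τ with hσ
  have hσ' : σ = ModularGroup.T ^ n • g • τ := by rw [hσ, mul_smul]
  have hmaxσ : ∀ h ∈ CongruenceSubgroup.Gamma1 4, (h • σ).im ≤ σ.im := by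
    intro h hh
    have h1 : σ.im = (g • τ).im := by rw [hσ', ModularGroup.im_T_zpow_smul]
    rw [h1, hσ, ← mul_smul]
    exact hmax _ (mul_mem hh (mul_mem (T_zpow_mem n) hg))
  have hden : ∀ (h : SL(2, ℤ)), h ∈ CongruenceSubgroup.Gamma1 4 →
      1 ≤ normSq (UpperHalfPlane.denom h σ) := by
    intro h hh
    have h1 := hmaxσ h hh
    rw [ModularGroup.im_smul_eq_div_normSq,
      div_le_iff₀ (UpperHalfPlane.normSq_denom_pos h σ.im_ne_zero)] at h1
    exact le_of_mul_le_mul_left (by simpa using h1) σ.im_pos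
  refine ⟨ModularGroup.T ^ n * g, mul_mem (T_zpow_mem n) hg, ?_, ?_, ?_, ?_⟩
  · rw [← hσ, hσ', ModularGroup.re_T_zpow_smul, hn]
    push_cast
    linarith [Int.floor_le (g • τ).re]
  · rw [← hσ, hσ', ModularGroup.re_T_zpow_smul, hn]
    push_cast
    linarith [Int.lt_floor_add_one (g • τ).re]
  · have h1 := hden (lowerUnipotent (-1)) (lowerUnipotent_mem _)
    have h2 : UpperHalfPlane.denom (lowerUnipotent (-1)) σ = -4 * (σ - 1 / 4) := by
      rw [ModularGroup.denom_apply]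
      simp [lowerUnipotent]
      ring
    rw [h2, normSq_eq_norm_sq, norm_mul] at h1
    norm_num at h1
    rw [← hσ]
    nlinarith [norm_nonneg ((σ : ℂ) - 1 / 4)]
  · let m : SL(2, ℤ) := ⟨!![1, -1; 4, -3], by simp [Matrix.det_fin_two]⟩
    have h1 := hden m ((mem_Gamma1_four_iff m).2 ⟨rfl, rfl, rfl⟩)
    have h2 : UpperHalfPlane.denom m σ = 4 * (σ - 3 / 4) := by
      rw [ModularGroup.denom_apply]
      simp [m]
      ring
    rw [h2, normSq_eq_norm_sq, norm_mul] at h1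
    norm_num at h1
    rw [← hσ]
    nlinarith [norm_nonneg ((σ : ℂ) - 3 / 4)]

lemma exists_smul_mem_extendedTile {τ : UpperHalfPlane} (him : (hauptmodul τ).im ≠ 0) :
    ∃ γ ∈ CongruenceSubgroup.Gamma1 4, ((γ • τ : UpperHalfPlane) : ℂ) ∈ extendedTile := by
  obtain ⟨γ, hγ, h0, h1, h2, h3⟩ := exists_smul_mem_closedTile τ
  refine ⟨γ, hγ, ?_⟩
  rw [← hauptmodul_smul hγ] at him
  have hpos := (γ • τ).im_pos
  set σ : ℂ := ((γ • τ : UpperHalfPlane) : ℂ)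
  have hcircle : ∀ s : ℂ, 0 < s.im → ‖s - 1 / 4‖ = 1 / 4 → (hauptmodul s).im = 0 := by
    intro s hs h
    have h4 : normSq s = s.re / 2 := by
      have h5 : (s - 1 / 4).re = s.re - 1 / 4 := by
        rw [show (1 / 4 : ℂ) = ((1 / 4 : ℝ) : ℂ) by push_cast; ring, sub_re, ofReal_re]
      have h6 : (s - 1 / 4).im = s.im := by
        rw [show (1 / 4 : ℂ) = ((1 / 4 : ℝ) : ℂ) by push_cast; ring, sub_im, ofReal_im, sub_zero]
      have h7 := normSq_eq_norm_sq (s - 1 / 4)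
      rw [h, normSq_apply, h5, h6] at h7
      rw [normSq_apply]
      linarith
    obtain ⟨y, -, hy⟩ := hauptmodul_of_semicircle hs h4
    rw [hy, ofReal_im]
  refine ⟨hpos, h0.lt_of_ne fun h => him ?_, h1, h2.lt_of_ne fun h => him ?_,
    h3.lt_of_ne fun h => him ?_⟩
  · obtain ⟨y, -, hy⟩ := hauptmodul_of_re_eq_zero hpos h.symm
    rw [hy, ofReal_im]
  · exact hcircle σ hpos h.symm
  · rw [norm_sub_three_quarters] at h
    have h4 := hcircle (reflect σ) (by rw [reflect_im]; exact hpos) h.symm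
    rw [hauptmodul_reflect, conj_im, neg_eq_zero] at h4
    exact h4

lemma exists_smul_eq_of_im_ne_zero {τ τ' : UpperHalfPlane} (h : hauptmodul τ = hauptmodul τ')
    (him : (hauptmodul τ).im ≠ 0) : ∃ γ ∈ CongruenceSubgroup.Gamma1 4, γ • τ = τ' := by
  obtain ⟨γ, hγ, h1⟩ := exists_smul_mem_extendedTile him
  obtain ⟨γ', hγ', h1'⟩ := exists_smul_mem_extendedTile (h ▸ him)
  refine ⟨γ'⁻¹ * γ, mul_mem (inv_mem hγ') hγ, ?_⟩
  rw [mul_smul, inv_smul_eq_iff]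
  apply UpperHalfPlane.ext
  exact injOn_extendedTile h1 h1' (by rw [hauptmodul_smul hγ, hauptmodul_smul hγ', h])

lemma finite_smul_inter {K L : Set UpperHalfPlane} (hK : IsCompact K) (hL : IsCompact L) :
    {γ : SL(2, ℤ) | ∃ t ∈ K, γ • t ∈ L}.Finite := by
  have h := ProperlyDiscontinuousSMul.finite_disjoint_inter_image (Γ := 𝒮ℒ) hK hL
  let m : SL(2, ℤ) → 𝒮ℒ := fun γ => ⟨Matrix.SpecialLinearGroup.mapGL ℝ γ, γ, rfl⟩
  have hm : Function.Injective m := fun a b hab =>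
    Matrix.SpecialLinearGroup.mapGL_injective (Subtype.ext_iff.1 hab)
  refine (h.preimage hm.injOn).subset ?_
  rintro γ ⟨t, ht, htL⟩
  have hne : (((fun s => m γ • s) '' K) ∩ L).Nonempty := ⟨γ • t, ⟨t, ht, rfl⟩, htL⟩
  exact hne

/-- Two points with the same real value are limits of points with a common non-real value, which
lie in the same orbit. By proper discontinuity of the action, so do the two points. -/
lemma exists_smul_eq {τ τ' : UpperHalfPlane} (h : hauptmodul τ = hauptmodul τ') :
    ∃ γ ∈ CongruenceSubgroup.Gamma1 4, γ • τ = τ' := by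
  by_contra! hne
  obtain ⟨K, hK, hKτ⟩ := exists_compact_mem_nhds τ
  obtain ⟨L, hL, hLτ⟩ := exists_compact_mem_nhds τ'
  have hfin := finite_smul_inter hK hL
  have hev : ∀ᶠ p : UpperHalfPlane × UpperHalfPlane in 𝓝 (τ, τ'),
      ∀ γ ∈ {γ : SL(2, ℤ) | ∃ t ∈ K, γ • t ∈ L}, γ ∈ CongruenceSubgroup.Gamma1 4 →
        γ • p.1 ≠ p.2 := by
    rw [eventually_all_finite hfin]
    intro γ _
    by_cases hγ : γ ∈ CongruenceSubgroup.Gamma1 4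
    · have hc : Continuous fun p : UpperHalfPlane × UpperHalfPlane => γ • p.1 :=
        (continuous_const_smul (Matrix.SpecialLinearGroup.mapGL ℝ γ)).comp continuous_fst
      filter_upwards [(hc.continuousAt.ne_iff_eventually_ne continuous_snd.continuousAt).1
        (hne γ hγ)] with p hp _ using hp
    · exact Eventually.of_forall fun _ hc => absurd hc hγ
  rw [nhds_prod_eq] at hev
  obtain ⟨pa, ha, pb, hb, hab⟩ := eventually_prod_iff.1 hev
  have hU := UpperHalfPlane.isOpenEmbedding_coe.image_mem_nhds.2 (inter_mem ha hKτ)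
  have hU' := UpperHalfPlane.isOpenEmbedding_coe.image_mem_nhds.2 (inter_mem hb hLτ)
  obtain ⟨_, ⟨t, ht, rfl⟩, _, ⟨t', ht', rfl⟩, heq, him⟩ :=
    frequently_eq_im_ne_zero τ.im_pos τ'.im_pos h hU hU'
  obtain ⟨γ, hγ, hγt⟩ := exists_smul_eq_of_im_ne_zero heq him
  exact hab ht.1 ht'.1 γ ⟨t, ht.2, by rw [hγt]; exact ht'.2⟩ hγ hγt

lemma isConformalQuotient_hauptmodul : IsConformalQuotient hauptmodul where
  image_eq := image_hauptmodul_halfPlane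
  conformal _ hτ := ⟨(hasDerivAt_hauptmodul hτ).differentiableAt, deriv_hauptmodul_ne_zero hτ⟩
  fibres _ _ := ⟨exists_smul_eq, by rintro ⟨γ, hγ, rfl⟩; exact (hauptmodul_smul hγ _).symm⟩

/-- As `dπ = 2πi π θ⁴ dτ` does not vanish and `π` is onto, `ω` is determined by its pullback. -/
lemma pullback_hauptmodul_eqOn_iff (ω : OneForm) :
    Set.EqOn (pullback hauptmodul ω) Theta halfPlane ↔ Set.EqOn ω dzOver puncturedSphere := by
  have hpt : ∀ τ ∈ halfPlane, (pullback hauptmodul ω τ = Theta τ ↔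
      ω (hauptmodul τ) = dzOver (hauptmodul τ)) := by
    intro τ hτ
    have h0 := hauptmodul_ne_zero hτ
    have ht := theta_ne_zero (norm_nome_lt_one hτ)
    have hd := (hasDerivAt_hauptmodul hτ).hasFDerivAt.fderiv
    have hpi : (Real.pi : ℂ) ≠ 0 := by simp [Real.pi_ne_zero]
    have hc : ∀ L : ℂ →L[ℂ] ℂ, ∀ c : ℂ, L c = c * L 1 := by
      intro L c
      rw [← smul_eq_mul, ← L.map_smul, smul_eq_mul, mul_one]
    rw [ContinuousLinearMap.ext_ring_iff, ContinuousLinearMap.ext_ring_iff, pullback, hd, Theta,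
      dzOver]
    change ω (hauptmodul τ) ((1 : ℂ) • _) = theta (nome τ) ^ 4 • (1 : ℂ) ↔
      _ = (1 / (2 * Real.pi * I * hauptmodul τ)) • (1 : ℂ)
    rw [one_smul, hc, smul_eq_mul, smul_eq_mul, mul_one, mul_one]
    have hI := I_ne_zero
    rw [eq_div_iff (by simp [h0, hpi])]
    constructor
    · intro h
      apply mul_left_cancel₀ (pow_ne_zero 4 ht)
      linear_combination h
    · intro h
      linear_combination theta (nome τ) ^ 4 * h
  constructor
  · intro h z hz
    rw [← image_hauptmodul_halfPlane] at hz
    obtain ⟨τ, hτ, rfl⟩ := hz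
    exact (hpt τ hτ).1 (h hτ)
  · intro h τ hτ
    refine (hpt τ hτ).2 (h ?_)
    rw [← image_hauptmodul_halfPlane]
    exact ⟨τ, hτ, rfl⟩

/-! ### Automorphisms of the disc -/

lemma bijOn_invFunOn {f : ℂ → ℂ} {s t : Set ℂ} (h : Set.BijOn f s t) :
    Set.BijOn (Function.invFunOn f s) t s :=
  h.symm h.invOn_invFunOn.symm

lemma hasDerivAt_invFunOn {f : ℂ → ℂ} {s : Set ℂ} (hs : IsOpen s) (hf : DifferentiableOn ℂ f s)
    (hinj : Set.InjOn f s) {z : ℂ} (hz : z ∈ s) (h0 : deriv f z ≠ 0) :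
    HasDerivAt (Function.invFunOn f s) (deriv f z)⁻¹ (f z) := by
  have h1 := (hf.analyticAt (hs.mem_nhds hz)).hasStrictDerivAt
  refine (h1.to_local_left_inverse h0 ?_).hasDerivAt
  filter_upwards [hs.mem_nhds hz] with x hx using hinj.leftInvOn_invFunOn hx

lemma differentiableOn_invFunOn {f : ℂ → ℂ} {s t : Set ℂ} (hs : IsOpen s)
    (hf : DifferentiableOn ℂ f s) (hbij : Set.BijOn f s t) (h0 : ∀ z ∈ s, deriv f z ≠ 0) :
    DifferentiableOn ℂ (Function.invFunOn f s) t := by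
  intro w hw
  obtain ⟨z, hz, rfl⟩ := hbij.surjOn hw
  exact (hasDerivAt_invFunOn hs hf hbij.injOn hz
    (h0 z hz)).differentiableAt.differentiableWithinAt

/-- The open sets `g(B(0, R))`, `R < 1`, exhaust the disc. -/
lemma exists_lt_norm_of_bijOn_ball {g : ℂ → ℂ} (hd : DifferentiableOn ℂ g (Metric.ball 0 1))
    (hb : Set.BijOn g (Metric.ball 0 1) (Metric.ball 0 1)) {ρ : ℝ} (hρ : ρ < 1) :
    ∃ R : ℝ, 0 < R ∧ R < 1 ∧ ∀ z : ℂ, ‖z‖ = R → ρ ≤ ‖g z‖ := by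
  have hopen : ∀ s ⊆ Metric.ball (0 : ℂ) 1, IsOpen s → IsOpen (g '' s) := by
    have hA : AnalyticOnNhd ℂ g (Metric.ball 0 1) := hd.analyticOnNhd Metric.isOpen_ball
    refine (hA.is_constant_or_isOpen
      (convex_ball 0 1).isPreconnected).resolve_left ?_
    rintro ⟨w, hw⟩
    have h1 : (0 : ℂ) ∈ Metric.ball (0 : ℂ) 1 := by simp
    have h2 : (1 / 2 : ℂ) ∈ Metric.ball (0 : ℂ) 1 := by
      rw [mem_ball_zero_iff]; norm_num
    have := hb.injOn h1 h2 ((hw 0 h1).trans (hw _ h2).symm)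
    norm_num at this
  have hsub : ∀ R : Set.Ioo (0 : ℝ) 1, Metric.ball (0 : ℂ) R ⊆ Metric.ball 0 1 :=
    fun R => Metric.ball_subset_ball R.2.2.le
  have : Nonempty (Set.Ioo (0 : ℝ) 1) := ⟨⟨1 / 2, by norm_num⟩⟩
  obtain ⟨R, hR⟩ := (isCompact_closedBall (0 : ℂ) ρ).elim_directed_cover
    (fun R : Set.Ioo (0 : ℝ) 1 => g '' Metric.ball 0 (R : ℝ))
    (fun R => hopen _ (hsub R) Metric.isOpen_ball)
    (by
      intro w hw
      obtain ⟨z, hz, rfl⟩ := hb.surjOn (Metric.closedBall_subset_ball hρ hw)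
      obtain ⟨R, hzR, hR⟩ := exists_between (mem_ball_zero_iff.1 hz)
      exact Set.mem_iUnion.2 ⟨⟨R, (norm_nonneg z).trans_lt hzR, hR⟩, z, by simpa using hzR, rfl⟩)
    (by
      intro R R'
      rcases le_total (R : ℝ) R' with h | h
      · exact ⟨R', Set.image_mono (Metric.ball_subset_ball h), subset_rfl⟩
      · exact ⟨R, subset_rfl, Set.image_mono (Metric.ball_subset_ball h)⟩)
  refine ⟨R, R.2.1, R.2.2, fun z hz => ?_⟩
  by_contra hlt
  obtain ⟨z', hz', heq⟩ := hR (mem_closedBall_zero_iff.2 (not_le.1 hlt).le)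
  have h1 : z ∈ Metric.ball (0 : ℂ) 1 := by rw [mem_ball_zero_iff, hz]; exact R.2.2
  have h2 := hb.injOn (hsub R hz') h1 heq
  rw [h2, mem_ball_zero_iff, hz] at hz'
  exact lt_irrefl _ hz'

/-- The Schwarz lemma bounds `g(z)/z` by `1`; the maximum principle for the reciprocal shows that
the bound is attained at `0`. -/
lemma eq_id_of_bijOn_ball {g : ℂ → ℂ} (hd : DifferentiableOn ℂ g (Metric.ball 0 1))
    (hb : Set.BijOn g (Metric.ball 0 1) (Metric.ball 0 1)) (h0 : g 0 = 0) {r : ℝ} (hr : 0 < r)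
    (hder : deriv g 0 = r) : Set.EqOn g id (Metric.ball 0 1) := by
  have hmem0 : (0 : ℂ) ∈ Metric.ball (0 : ℂ) 1 := by simp
  set k := dslope g 0 with hk
  have hk0 : k 0 = r := by rw [hk, dslope_same, hder]
  have hkne : ∀ z : ℂ, z ≠ 0 → k z = z⁻¹ * g z := fun z hz => by
    rw [hk, dslope_of_ne _ hz, slope_def_field, h0, sub_zero, sub_zero, div_eq_inv_mul]
  have hkd : DifferentiableOn ℂ k (Metric.ball 0 1) :=
    (differentiableOn_dslope (Metric.ball_mem_nhds 0 one_pos)).2 hd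
  have hknz : ∀ z ∈ Metric.ball (0 : ℂ) 1, k z ≠ 0 := by
    intro z hz
    rcases eq_or_ne z 0 with rfl | hz0
    · rw [hk0]; exact_mod_cast hr.ne'
    · rw [hkne z hz0]
      refine mul_ne_zero (inv_ne_zero hz0) fun hg => hz0 (hb.injOn hz hmem0 (hg.trans h0.symm))
  have hge : ∀ ρ : ℝ, 0 < ρ → ρ < 1 → ρ ≤ r := by
    intro ρ hρ0 hρ
    obtain ⟨R, hR0, hR1, hR⟩ := exists_lt_norm_of_bijOn_ball hd hb hρ
    have hinv : DifferentiableOn ℂ (fun z => (k z)⁻¹) (Metric.ball 0 1) := hkd.inv hknz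
    have hcl : DiffContOnCl ℂ (fun z => (k z)⁻¹) (Metric.ball 0 R) := by
      refine DifferentiableOn.diffContOnCl (hinv.mono ?_)
      exact Metric.closure_ball_subset_closedBall.trans (Metric.closedBall_subset_ball hR1)
    have hle := norm_le_of_forall_mem_frontier_norm_le (C := ρ⁻¹) Metric.isBounded_ball hcl
      (by
        intro z hz
        rw [frontier_ball _ hR0.ne', mem_sphere_zero_iff_norm] at hz
        have hz0 : z ≠ 0 := by rintro rfl; simp at hz; exact hR0.ne hz
        have hg := hR z hz
        rw [hkne z hz0, mul_inv, inv_inv, norm_mul, norm_inv, hz]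
        have : ‖g z‖⁻¹ ≤ ρ⁻¹ := inv_anti₀ hρ0 hg
        calc R * ‖g z‖⁻¹ ≤ 1 * ρ⁻¹ := by gcongr
          _ = ρ⁻¹ := one_mul _)
      (subset_closure (Metric.mem_ball_self hR0))
    rw [hk0, norm_inv, norm_real, Real.norm_of_nonneg hr.le] at hle
    exact (inv_le_inv₀ hr hρ0).1 hle
  have hmaps : Set.MapsTo g (Metric.ball 0 1) (Metric.closedBall (g 0) 1) := by
    rw [h0]; exact hb.mapsTo.mono_right Metric.ball_subset_closedBall
  have hle : r ≤ 1 := by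
    have := norm_dslope_le_div_of_mapsTo_ball hd hmaps hmem0
    rw [← hk, hk0, norm_real, Real.norm_of_nonneg hr.le] at this
    simpa using this
  have hr1 : r = 1 := le_antisymm hle (le_of_forall_lt_imp_le_of_dense fun ρ hρ => by
    rcases le_or_gt ρ 0 with h | h
    · exact h.trans hr.le
    · exact hge ρ h hρ)
  have haff := affine_of_mapsTo_ball_of_norm_dslope_eq_div hd hmaps hmem0
    (by rw [← hk, hk0, hr1]; simp)
  intro z hz
  rw [haff hz, ← hk, hk0, hr1, h0]
  simp

/-! ### A conformal map from the disc to the slit plane -/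

/-- The map `ζ ↦ 1/2 + 1/(ζ + ζ⁻¹)` from the unit disc to the slit plane. -/
noncomputable def discToSlit (ζ : ℂ) : ℂ := 1 / 2 + ζ / (1 + ζ ^ 2)

lemma one_add_sq_ne_zero_of_mem_ball {ζ : ℂ} (h : ζ ∈ Metric.ball (0 : ℂ) 1) : 1 + ζ ^ 2 ≠ 0 := by
  intro hc
  have h1 : ζ ^ 2 = -1 := by linear_combination hc
  have h2 := congrArg norm h1
  rw [norm_pow, norm_neg, norm_one] at h2
  have := pow_lt_one₀ (norm_nonneg ζ) (mem_ball_zero_iff.1 h) two_ne_zero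
  linarith

lemma hasDerivAt_discToSlit {ζ : ℂ} (h : ζ ∈ Metric.ball (0 : ℂ) 1) :
    HasDerivAt discToSlit ((1 - ζ ^ 2) / (1 + ζ ^ 2) ^ 2) ζ := by
  have h1 := ((hasDerivAt_id ζ).div ((hasDerivAt_pow 2 ζ).const_add 1)
    (one_add_sq_ne_zero_of_mem_ball h)).const_add (1 / 2)
  convert! h1 using 1
  simp
  ring

lemma deriv_discToSlit_ne_zero {ζ : ℂ} (h : ζ ∈ Metric.ball (0 : ℂ) 1) :
    deriv discToSlit ζ ≠ 0 := by
  rw [(hasDerivAt_discToSlit h).deriv]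
  refine div_ne_zero ?_ (pow_ne_zero 2 (one_add_sq_ne_zero_of_mem_ball h))
  intro hc
  have h1 : ζ ^ 2 = 1 := by linear_combination -hc
  have h2 := congrArg norm h1
  rw [norm_pow, norm_one] at h2
  have := pow_lt_one₀ (norm_nonneg ζ) (mem_ball_zero_iff.1 h) two_ne_zero
  linarith

lemma not_mem_slitDomain_iff {z : ℂ} : z ∉ slitDomain ↔ ∃ y : ℝ, 1 / 2 ≤ |y| ∧ z = 1 / 2 + y := by
  simp only [slitDomain, Set.mem_ofPred_eq, not_not]
  constructor
  · rintro ⟨h1, h2⟩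
    refine ⟨z.re - 1 / 2, ?_, ?_⟩
    · rw [le_abs]
      rcases h2 with h | h
      · right; linarith
      · left; linarith
    · apply Complex.ext <;> simp [h1]
  · rintro ⟨y, hy, rfl⟩
    refine ⟨by simp, ?_⟩
    rw [le_abs] at hy
    have : (1 / 2 + (y : ℂ)).re = 1 / 2 + y := by simp
    rw [this]
    rcases hy with h | h
    · right; linarith
    · left; linarith

lemma bijOn_discToSlit : Set.BijOn discToSlit (Metric.ball 0 1) slitDomain := by
  refine ⟨?_, ?_, ?_⟩
  · intro ζ hζ
    by_contra hc
    obtain ⟨y, hy, h⟩ := not_mem_slitDomain_iff.1 hc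
    have h1 : (y : ℂ) * (1 + ζ ^ 2) = ζ := by
      have h0 := one_add_sq_ne_zero_of_mem_ball hζ
      have h2 : ζ / (1 + ζ ^ 2) = y := by rw [discToSlit] at h; linear_combination h
      rw [← h2]
      field_simp
    have h2 : (y : ℂ) * (1 + starRingEnd ℂ ζ ^ 2) = starRingEnd ℂ ζ := by
      have := congrArg (starRingEnd ℂ) h1
      simpa using this
    have hy0 : (y : ℂ) ≠ 0 := by
      have : y ≠ 0 := by rintro rfl; norm_num at hy
      exact_mod_cast this
    have h3 : (ζ - starRingEnd ℂ ζ) * (1 - ζ * starRingEnd ℂ ζ) = 0 := by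
      apply mul_left_cancel₀ hy0
      linear_combination (-starRingEnd ℂ ζ) * h1 + ζ * h2
    have hn := mem_ball_zero_iff.1 hζ
    rcases mul_eq_zero.1 h3 with h4 | h4
    · obtain ⟨x, rfl⟩ := conj_eq_iff_real.1 (sub_eq_zero.1 h4).symm
      have h5 : y * (1 + x ^ 2) = x := by exact_mod_cast h1
      rw [norm_real, Real.norm_eq_abs] at hn
      have h6 := congrArg abs h5
      rw [abs_mul, abs_of_pos (by positivity : 0 < 1 + x ^ 2), ← sq_abs x] at h6
      nlinarith [mul_pos (sub_pos.2 hn) (sub_pos.2 hn), sq_nonneg |x|]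
    · rw [mul_conj, normSq_eq_norm_sq] at h4
      have h5 : (1 : ℝ) - ‖ζ‖ ^ 2 = 0 := by exact_mod_cast h4
      nlinarith [norm_nonneg ζ]
  · intro ζ hζ ξ hξ h
    have h1 := one_add_sq_ne_zero_of_mem_ball hζ
    have h2 := one_add_sq_ne_zero_of_mem_ball hξ
    have h3 : ζ / (1 + ζ ^ 2) = ξ / (1 + ξ ^ 2) := by
      rw [discToSlit, discToSlit] at h; linear_combination h
    rw [div_eq_div_iff h1 h2] at h3
    have h4 : (ζ - ξ) * (1 - ζ * ξ) = 0 := by linear_combination h3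
    rcases mul_eq_zero.1 h4 with h5 | h5
    · exact sub_eq_zero.1 h5
    · exfalso
      have h6 := congrArg norm (sub_eq_zero.1 h5)
      rw [norm_mul, norm_one] at h6
      have := mul_lt_one_of_nonneg_of_lt_one_left (norm_nonneg ζ) (mem_ball_zero_iff.1 hζ)
        (mem_ball_zero_iff.1 hξ).le
      linarith
  · intro z hz
    rcases eq_or_ne z (1 / 2) with rfl | hne
    · exact ⟨0, by simp, by simp [discToSlit]⟩
    have hy0 : z - 1 / 2 ≠ 0 := sub_ne_zero.2 hne
    obtain ⟨s, hs⟩ := IsAlgClosed.exists_eq_mul_self (((z - 1 / 2)⁻¹) ^ 2 - 4)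
    -- the two roots of `ζ² - ζ / (z - 1/2) + 1`, whose product is `1`
    set a := ((z - 1 / 2)⁻¹ + s) / 2 with ha
    set b := ((z - 1 / 2)⁻¹ - s) / 2 with hb
    have hab : a * b = 1 := by rw [ha, hb]; linear_combination (1 / 4) * hs
    have hsum : a + b = (z - 1 / 2)⁻¹ := by rw [ha, hb]; ring
    have key : ∀ a b : ℂ, a * b = 1 → a + b = (z - 1 / 2)⁻¹ → ‖a‖ < 1 →
        ∃ ζ ∈ Metric.ball (0 : ℂ) 1, discToSlit ζ = z := by
      intro a b hab hsum hlt
      refine ⟨a, by simpa using hlt, ?_⟩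
      have h1 := one_add_sq_ne_zero_of_mem_ball (by simpa using hlt : a ∈ Metric.ball (0 : ℂ) 1)
      have h2 : (z - 1 / 2) * (a + b) = 1 := by rw [hsum, mul_inv_cancel₀ hy0]
      rw [discToSlit]
      have h3 : a / (1 + a ^ 2) = z - 1 / 2 := by
        rw [div_eq_iff h1]
        linear_combination -a * h2 + (z - 1 / 2) * hab
      rw [h3]; ring
    have hnab : ‖a‖ * ‖b‖ = 1 := by rw [← norm_mul, hab, norm_one]
    rcases lt_trichotomy ‖a‖ 1 with h | h | h
    · exact key a b hab hsum h
    · exfalso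
      have hb' : b = starRingEnd ℂ a := by
        have h1 : a * starRingEnd ℂ a = 1 := by
          rw [mul_conj, normSq_eq_norm_sq, h]; norm_num
        have ha0 : a ≠ 0 := by rintro h0; rw [h0, zero_mul] at hab; exact zero_ne_one hab
        exact mul_left_cancel₀ ha0 (hab.trans h1.symm)
      rw [hb', add_conj] at hsum
      have hre : (2 * a.re : ℝ) ≠ 0 := by
        intro h0
        rw [h0] at hsum
        exact inv_ne_zero hy0 (by rw [← hsum]; simp)
      refine not_mem_slitDomain_iff.2 ⟨(2 * a.re)⁻¹, ?_, ?_⟩ hz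
      · rw [abs_inv, one_div]
        refine inv_anti₀ (abs_pos.2 hre) ?_
        rw [abs_mul, abs_two]
        have := abs_re_le_norm a
        linarith
      · rw [ofReal_inv, hsum, inv_inv]; ring
    · refine key b a (by rw [mul_comm, hab]) (by rw [add_comm, hsum]) ?_
      nlinarith [norm_nonneg b]

/-! ### The Riemann map -/

lemma base_mem : (1 + I) / 2 ∈ extendedTile :=
  mem_extendedTile_of_re_eq_half (by simp) (by simp)

lemma hauptmodul_base : hauptmodul ((1 + I) / 2) = 1 / 2 := by
  have h0 : 0 < (I / 2).im := by simp
  have h1 := hauptmodul_fricke h0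
  have h2 : fricke (I / 2) = I / 2 := by
    rw [fricke]
    have := I_ne_zero
    field_simp
    rw [I_sq]; norm_num
  rw [h2] at h1
  have h3 := hauptmodul_ne_zero h0
  have h4 : hauptmodul (I / 2) = -1 := by
    have h5 : (hauptmodul (I / 2) - 1) * (hauptmodul (I / 2) + 1) = 0 := by
      have : hauptmodul (I / 2) * hauptmodul (I / 2) = 1 := by
        nth_rewrite 1 [h1]
        exact inv_mul_cancel₀ h3
      linear_combination this
    have h6 := (mul_eq_zero.1 h5).resolve_left (sub_ne_zero.2 (hauptmodul_ne_one h0))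
    linear_combination h6
  have h5 := one_sub_hauptmodul_add_half h0
  rw [h4, show I / 2 + 1 / 2 = (1 + I) / 2 by ring] at h5
  linear_combination (-1 / 2) * h5

lemma deriv_hauptmodul_base : ∃ t : ℝ, 0 < t ∧ deriv hauptmodul ((1 + I) / 2) = t * I := by
  have him : 0 < ((1 + I) / 2).im := by simp
  have hre : ((1 + I) / 2).re = 1 / 2 := by simp
  have h1 := nome_of_re_eq_half hre
  have h2 := theta_ne_zero (norm_nome_lt_one him)
  have h3 : starRingEnd ℂ (theta (nome ((1 + I) / 2))) = theta (nome ((1 + I) / 2)) := by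
    rw [← theta_conj, h1, map_neg, conj_ofReal]
  obtain ⟨x, hx⟩ := conj_eq_iff_real.1 h3
  have hx0 : x ≠ 0 := by rintro rfl; rw [hx] at h2; simp at h2
  refine ⟨Real.pi * x ^ 4, by positivity, ?_⟩
  rw [(hasDerivAt_hauptmodul him).deriv, hauptmodul_base, hx]
  push_cast
  ring

lemma isRiemannMap_invFunOn : IsRiemannMap (Function.invFunOn hauptmodul extendedTile) := by
  have hd := differentiableOn_hauptmodul.mono extendedTile_subset
  have hinj := bijOn_extendedTile.injOn
  have hder := hasDerivAt_invFunOn isOpen_extendedTile hd hinj base_mem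
    (deriv_hauptmodul_ne_zero base_mem.1)
  refine ⟨differentiableOn_invFunOn isOpen_extendedTile hd bijOn_extendedTile
    fun z hz => deriv_hauptmodul_ne_zero hz.1, bijOn_invFunOn bijOn_extendedTile, ?_, ?_⟩
  · rw [← hauptmodul_base]
    exact hinj.leftInvOn_invFunOn base_mem
  · obtain ⟨t, ht, htd⟩ := deriv_hauptmodul_base
    refine ⟨t⁻¹, inv_pos.2 ht, ?_⟩
    rw [hauptmodul_base] at hder
    rw [hder.deriv, htd, mul_inv, inv_I]
    push_cast
    ring

/-- The hauptmodul is a left inverse of each normalised Riemann map: on the disc, the composition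
of the two is an automorphism with fixed point `0` and positive derivative there. -/
lemma hauptmodul_of_isRiemannMap {f : ℂ → ℂ} (hf : IsRiemannMap f) {z : ℂ} (hz : z ∈ slitDomain) :
    hauptmodul (f z) = z := by
  set χ := Function.invFunOn discToSlit (Metric.ball 0 1) with hχ
  have hψd : DifferentiableOn ℂ discToSlit (Metric.ball 0 1) := fun ζ hζ =>
    (hasDerivAt_discToSlit hζ).differentiableAt.differentiableWithinAt
  have hχd : DifferentiableOn ℂ χ slitDomain := differentiableOn_invFunOn Metric.isOpen_ball hψd
    bijOn_discToSlit fun ζ hζ => deriv_discToSlit_ne_zero hζ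
  have hχb : Set.BijOn χ slitDomain (Metric.ball 0 1) := bijOn_invFunOn bijOn_discToSlit
  have h0 : (0 : ℂ) ∈ Metric.ball (0 : ℂ) 1 := by simp
  have hψ0 : discToSlit 0 = 1 / 2 := by simp [discToSlit]
  have hχ0 : χ (1 / 2) = 0 := by
    rw [← hψ0]; exact bijOn_discToSlit.injOn.leftInvOn_invFunOn h0
  have hhalf : (1 / 2 : ℂ) ∈ slitDomain := hψ0 ▸ bijOn_discToSlit.mapsTo h0
  set g : ℂ → ℂ := χ ∘ hauptmodul ∘ f ∘ discToSlit with hg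
  have hgb : Set.BijOn g (Metric.ball 0 1) (Metric.ball 0 1) :=
    hχb.comp (bijOn_extendedTile.comp (hf.bijective.comp bijOn_discToSlit))
  have hgd : DifferentiableOn ℂ g (Metric.ball 0 1) := by
    refine hχd.comp ((differentiableOn_hauptmodul.mono extendedTile_subset).comp
      (hf.holomorphic.comp hψd bijOn_discToSlit.mapsTo)
      (hf.bijective.comp bijOn_discToSlit).mapsTo) ?_
    exact (bijOn_extendedTile.comp (hf.bijective.comp bijOn_discToSlit)).mapsTo
  have hg0 : g 0 = 0 := by
    simp only [hg, Function.comp, hψ0, hf.base_point, hauptmodul_base, hχ0]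
  obtain ⟨r, hr, hrd⟩ := hf.direction
  obtain ⟨t, ht, htd⟩ := deriv_hauptmodul_base
  have hder : HasDerivAt g ((t * r : ℝ) : ℂ) 0 := by
    have d1 : HasDerivAt discToSlit 1 0 := by simpa using hasDerivAt_discToSlit h0
    -- a function with nonzero derivative at a point is differentiable there
    have d2 : HasDerivAt f (-(r * I)) (1 / 2) := by
      rw [← hrd]
      refine (differentiableAt_of_deriv_ne_zero ?_).hasDerivAt
      rw [hrd, neg_ne_zero]
      exact mul_ne_zero (by exact_mod_cast hr.ne') I_ne_zero
    have d3 : HasDerivAt hauptmodul (t * I) ((1 + I) / 2) := by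
      rw [← htd]; exact (hasDerivAt_hauptmodul base_mem.1).differentiableAt.hasDerivAt
    have d4 : HasDerivAt χ 1 (1 / 2) := by
      have := hasDerivAt_invFunOn Metric.isOpen_ball hψd bijOn_discToSlit.injOn h0
        (deriv_discToSlit_ne_zero h0)
      rwa [hψ0, d1.deriv, inv_one] at this
    rw [← hψ0] at d2
    have d5 := d2.comp (0 : ℂ) d1
    have e5 : (f ∘ discToSlit) 0 = (1 + I) / 2 := by rw [Function.comp, hψ0, hf.base_point]
    rw [← e5] at d3
    have d6 := d3.comp (0 : ℂ) d5
    have e6 : (hauptmodul ∘ f ∘ discToSlit) 0 = 1 / 2 := by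
      rw [Function.comp, e5, hauptmodul_base]
    rw [← e6] at d4
    have d7 := d4.comp (0 : ℂ) d6
    convert! d7 using 1
    push_cast
    linear_combination (t * r : ℂ) * I_sq
  have hid := eq_id_of_bijOn_ball hgd hgb hg0 (mul_pos ht hr) hder.deriv
  obtain ⟨ζ, hζ, rfl⟩ := bijOn_discToSlit.surjOn hz
  have h1 : χ (hauptmodul (f (discToSlit ζ))) = ζ := hid hζ
  have h2 := mapsTo_extendedTile (hf.bijective.mapsTo (bijOn_discToSlit.mapsTo hζ))
  rw [← bijOn_discToSlit.surjOn.rightInvOn_invFunOn h2]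
  exact congrArg discToSlit h1

lemma isUniformization_hauptmodul {f : ℂ → ℂ} (hf : IsRiemannMap f) :
    IsUniformization f hauptmodul :=
  ⟨differentiableOn_hauptmodul, fun _ => hauptmodul_of_isRiemannMap hf⟩

lemma isPreconnected_halfPlane : IsPreconnected halfPlane := isPreconnected_upper

lemma IsUniformization.eqOn_hauptmodul {f π : ℂ → ℂ} (hf : IsRiemannMap f)
    (hπ : IsUniformization f π) : Set.EqOn π hauptmodul halfPlane := by
  refine (hπ.holomorphic.analyticOnNhd isOpen_halfPlane).eqOn_of_preconnected_of_eventuallyEq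
    (differentiableOn_hauptmodul.analyticOnNhd isOpen_halfPlane) isPreconnected_halfPlane
    (extendedTile_subset base_mem) ?_
  filter_upwards [isOpen_extendedTile.mem_nhds base_mem] with τ hτ
  obtain ⟨z, hz, rfl⟩ := hf.bijective.surjOn hτ
  rw [hπ.inverse z hz, hauptmodul_of_isRiemannMap hf hz]

end ThetaForm


theorem mainTheorem3 :
    (∃ f : ℂ → ℂ, ThetaForm.IsRiemannMap f) ∧
    ∀ f : ℂ → ℂ, ThetaForm.IsRiemannMap f →
      ∃ π : ℂ → ℂ, ThetaForm.IsUniformization f π ∧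
        (∀ π' : ℂ → ℂ, ThetaForm.IsUniformization f π' →
          Set.EqOn π' π ThetaForm.halfPlane) ∧
        ThetaForm.IsConformalQuotient π ∧
        ∀ ω : ThetaForm.OneForm,
          Set.EqOn (ThetaForm.pullback π ω) ThetaForm.Theta ThetaForm.halfPlane ↔
            Set.EqOn ω ThetaForm.dzOver ThetaForm.puncturedSphere :=
  ⟨⟨_, ThetaForm.isRiemannMap_invFunOn⟩, fun _ hf =>
    ⟨ThetaForm.hauptmodul, ThetaForm.isUniformization_hauptmodul hf,
      fun _ hπ => hπ.eqOn_hauptmodul hf, ThetaForm.isConformalQuotient_hauptmodul,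
      ThetaForm.pullback_hauptmodul_eqOn_iff⟩⟩
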